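/- Let $n,r$ be natural numbers, $\mathbf m_1,\dots,\mathbf m_n\in\mathbb Z^r$, $\mathbf m_i=(m_{i1},\dots,m_{ir})$, and let the torus $T^r=\{\lambda\in\mathbb C^r:|\lambda_j|=1\}$ act on $\mathbb C^n$ by $\rho(\lambda)z=(\lambda^{\mathbf m_1}z_1,\dots,\lambda^{\mathbf m_n}z_n)$, $\lambda^{\mathbf m_i}=\prod_j\lambda_j^{m_{ij}}$. Assume that the only $\rho$-invariant holomorphic functions on $\mathbb C^n$ are the constants. Let $D\subset\mathbb C^n$ be a bounded quasi-Reinhardt domain containing $0$ with weights $\mathbf m_i$, that is, a bounded $\rho$-invariant domain with $0\in D$. For $1\le i\le n$ put $$E_i=\Big\{\alpha\in\mathbb N^n:\ \sum_{l=1}^n\alpha_l m_{lj}=m_{ij}\ \text{ for all } 1\le j\le r\Big\};$$ the monomials $z^\alpha$ with $\alpha\in E_i$ are called $i$-th resonant, and nonlinear if moreover $|\alpha|=\sum_l\alpha_l\ge 2$. Write $\mathbf m_i<\mathbf m_j$ if some $\alpha\in E_j$ has $\alpha_i\neq0$, and assume that the weights are properly ordered: whenever $\mathbf m_i\ne\mathbf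 m_j$ and $\mathbf m_i<\mathbf m_j$, one has $i<j$. Let $K_D(z,w)$ be the Bergman kernel of $D$ (the reproducing kernel of the space of square integrable holomorphic functions on $D$), let $T_D(z,w)$ be the $n\times n$ matrix with entries $\frac{\partial^2}{\partial\bar w_i\partial z_k}\log K_D(z,w)$, and let $$\sigma(z)=T_D(0,0)^{-1}\ \mathrm{grad}_{\bar w}\log\frac{K_D(z,w)}{K_D(w,w)}\Big|_{w=0}$$ be the Bergman representative coordinates at $0$. Then $\sigma$ is well defined on $D$ ($K_D(z,0)\neq0$ for all $z\in D$, and $T_D(0,0)$ is invertible), and for every $1\le i\le n$ one has $\sigma_i(z)=z_i+g_i(z)$ on $D$, where $g_i$ is a polynomial containing only nonlinear $i$-th resonant monomials. Moreover $\sigma$ is injective on $D$, and its inverse $\sigma^{-1}:\sigma(D)\to D$ has the same form: $(\sigma^{-1})_i(w)=w_i+h_i(w)$ on $\sigma(D)$, where $h_i$ is a polynomial containing only nonlinear $i$-th resonant monomials. -/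

import Mathlib

open MeasureTheory
open scoped ComplexConjugate

noncomputable section

namespace QuasiReinhardt

/-! ### Torus actions, weights and resonance -/

/-- The diagonal linear action of the torus `T^r` on `ℂⁿ` with weights `m i ∈ ℤ^r`:
`ρ(λ) z = (λ^{m₁} z₁, …, λ^{mₙ} zₙ)`, where `λ^{m_i} = ∏ j, λ_j ^ m_{ij}`. -/
def torusAction {n r : ℕ} (m : Fin n → Fin r → ℤ) (lam : Fin r → Circle)
    (z : Fin n → ℂ) : Fin n → ℂ :=
  fun i => (∏ j, (lam j : ℂ) ^ m i j) * z i

/-- The only holomorphic functions on `ℂⁿ` invariant under the torus action are the constants. -/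
def OnlyConstantInvariants {n r : ℕ} (m : Fin n → Fin r → ℤ) : Prop :=
  ∀ f : (Fin n → ℂ) → ℂ, Differentiable ℂ f →
    (∀ (lam : Fin r → Circle) (z : Fin n → ℂ), f (torusAction m lam z) = f z) →
    ∃ c : ℂ, ∀ z, f z = c

/-- `D` is a bounded quasi-Reinhardt domain of `ℂⁿ` containing the origin, with weights `m`. -/
structure IsBoundedQuasiReinhardt {n r : ℕ} (D : Set (Fin n → ℂ))
    (m : Fin n → Fin r → ℤ) : Prop where
  isOpen : IsOpen D
  isConnected : IsConnected D
  isBounded : Bornology.IsBounded D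
  zero_mem : (0 : Fin n → ℂ) ∈ D
  onlyConstantInvariants : OnlyConstantInvariants m
  invariant : ∀ (lam : Fin r → Circle), ∀ z ∈ D, torusAction m lam z ∈ D

/-- The `i`-th resonance set `E_i = {α ∈ ℕⁿ : ∑ l, α_l m_{lj} = m_{ij} for all j}`. -/
def resonanceSet {n r : ℕ} (m : Fin n → Fin r → ℤ) (i : Fin n) : Set (Fin n →₀ ℕ) :=
  {α | ∀ j : Fin r, ∑ l, (α l : ℤ) * m l j = m i j}

/-- The relation `m_i < m_j`: some `α ∈ E_j` has `α_i ≠ 0`. -/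
def WeightLT {n r : ℕ} (m : Fin n → Fin r → ℤ) (i j : Fin n) : Prop :=
  ∃ α ∈ resonanceSet m j, α i ≠ 0

/-- The weights are properly ordered: for distinct weights, `m_i < m_j` only for `i < j`.
Equal weights `m_i = m_j` are allowed and may appear in any order. -/
def ProperlyOrdered {n r : ℕ} (m : Fin n → Fin r → ℤ) : Prop :=
  ∀ i j : Fin n, m i ≠ m j → WeightLT m i j → i < j

/-- All monomials `z^α` of the polynomial `g` are nonlinear (`|α| ≥ 2`) and `i`-th resonant
(`α ∈ E_i`). -/
def OnlyNonlinearResonant {n r : ℕ} (m : Fin n → Fin r → ℤ) (i : Fin n)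
    (g : MvPolynomial (Fin n) ℂ) : Prop :=
  ∀ α ∈ g.support, 2 ≤ ∑ l, α l ∧ α ∈ resonanceSet m i

/-! ### Bergman kernel, metric tensor and representative coordinates -/

/-- `f` is a square integrable holomorphic function on `D` (Lebesgue measure on `ℂⁿ`). -/
def MemBergmanSpace {n : ℕ} (D : Set (Fin n → ℂ)) (f : (Fin n → ℂ) → ℂ) : Prop :=
  DifferentiableOn ℂ f D ∧ MemLp f 2 (volume.restrict D)

/-- `K` is a reproducing kernel of the space of square integrable holomorphic functions on `D`. -/
def IsBergmanKernel {n : ℕ} (D : Set (Fin n → ℂ))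
    (K : (Fin n → ℂ) → (Fin n → ℂ) → ℂ) : Prop :=
  (∀ w ∈ D, MemBergmanSpace D (fun z => K z w)) ∧
  ∀ f, MemBergmanSpace D f → ∀ w ∈ D, f w = ∫ z in D, f z * conj (K z w)

open Classical in
/-- The Bergman kernel `K_D(z, w)`, determined on `D × D` by its reproducing property. -/
def bergmanKernel {n : ℕ} (D : Set (Fin n → ℂ)) : (Fin n → ℂ) → (Fin n → ℂ) → ℂ :=
  if h : ∃ K, IsBergmanKernel D K then h.choose else 0

/-- The Wirtinger derivative `∂f/∂z_k = (∂f/∂x_k - i ∂f/∂y_k) / 2`. -/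
def wirtinger {n : ℕ} (k : Fin n) (f : (Fin n → ℂ) → ℂ) (z : Fin n → ℂ) : ℂ :=
  (fderiv ℝ f z (Pi.single k 1) - Complex.I * fderiv ℝ f z (Pi.single k Complex.I)) / 2

/-- The Wirtinger derivative `∂f/∂w̄_k = (∂f/∂x_k + i ∂f/∂y_k) / 2`. -/
def wirtingerBar {n : ℕ} (k : Fin n) (f : (Fin n → ℂ) → ℂ) (w : Fin n → ℂ) : ℂ :=
  (fderiv ℝ f w (Pi.single k 1) + Complex.I * fderiv ℝ f w (Pi.single k Complex.I)) / 2

/-- `∂ log f / ∂z_k = (∂f/∂z_k) / f`, independent of the branch of the logarithm. -/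
def wirtingerLog {n : ℕ} (k : Fin n) (f : (Fin n → ℂ) → ℂ) (z : Fin n → ℂ) : ℂ :=
  wirtinger k f z / f z

/-- `∂ log f / ∂w̄_k = (∂f/∂w̄_k) / f`, independent of the branch of the logarithm. -/
def wirtingerBarLog {n : ℕ} (k : Fin n) (f : (Fin n → ℂ) → ℂ) (w : Fin n → ℂ) : ℂ :=
  wirtingerBar k f w / f w

/-- The Bergman metric tensor `T_D(z, w)`, the `n × n` matrix with entries
`t_{ik}(z, w) = ∂²/(∂w̄_i ∂z_k) log K_D(z, w)`. -/
def bergmanTensor {n : ℕ} (D : Set (Fin n → ℂ)) (z w : Fin n → ℂ) :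
    Matrix (Fin n) (Fin n) ℂ :=
  Matrix.of fun i k =>
    wirtingerBar i (fun w' => wirtingerLog k (fun z' => bergmanKernel D z' w') z) w

/-- The Bergman representative coordinates at `ξ`:
`σ_ξ(z) = T_D(ξ, ξ)⁻¹ · grad_{w̄} log (K_D(z, w) / K_D(w, w))` at `w = ξ`. -/
def representativeCoordinates {n : ℕ} (D : Set (Fin n → ℂ)) (ξ z : Fin n → ℂ) : Fin n → ℂ :=
  Matrix.mulVec (bergmanTensor D ξ ξ)⁻¹
    (fun i => wirtingerBarLog i (fun w => bergmanKernel D z w / bergmanKernel D w w) ξ)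

end QuasiReinhardt

end

noncomputable section

namespace QuasiReinhardt

open Metric Set Filter Topology

/-! ### Holomorphic functions on normed spaces: limits, derivatives, identity theorem. -/

section Holomorphic

variable {E : Type*} [NormedAddCommGroup E] [NormedSpace ℂ E]

/-! The torus preserves `D` and Lebesgue measure, hence acts unitarily on the Bergman space. By
uniqueness in the Riesz theorem, a function representing an equivariant functional is therefore
semi-invariant (`isSemiInvariant_of_representing`).

Semi-invariant holomorphic functions of weight μ on `D` are polynomials (`exists_eval_eq`). Their
Taylor monomials at 0 all have weight μ. Since no nonconstant monomial is invariant, the exponents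
of weight μ form an antichain in ℕⁿ, which is finite. The identity theorem carries the equality from
a neighbourhood of 0 to all of `D`.

Evaluation at 0 is invariant, so K(·,0) is a constant c, nonzero because the Bergman space contains
1. Let φ_k represent ∂/∂z_k at 0; it is semi-invariant of weight m_k. Since K(w,w) is stationary at
w = 0, the gradient defining σ is c⁻¹φ(z), while T(0,0) is c⁻¹ times the matrix of derivatives
∂_kφ_i(0), a Gram matrix. It is invertible and commutes with the torus. Hence σ_i is semi-invariant
of weight m_i with differential dz_i at 0, i.e. z_i plus nonlinear resonant monomials.

A nonlinear i-th resonant monomial involves only variables z_l with l < i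
(`OnlyNonlinearResonant.lt`), so σ is triangular. It is inverted recursively by polynomials of the
same weights (`exists_inverse`). -/

theorem norm_fderiv_le_of_norm_le {f : E → ℂ} {c : E} {R M : ℝ} (hR : 0 < R)
    (hf : DifferentiableOn ℂ f (ball c R)) (hM : ∀ z ∈ ball c R, ‖f z‖ ≤ M) :
    ‖fderiv ℂ f c‖ ≤ 2 * M / R := by
  -- The factor 2 arises because the image lies in the closed ball of radius 2M about f(c).
  refine Complex.norm_fderiv_le_div_of_mapsTo_ball hf (fun z hz => ?_) hR
  rw [mem_closedBall, dist_eq_norm]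
  have := norm_sub_le (f z) (f c)
  linarith [hM z hz, hM c (mem_ball_self hR)]

/-- Uniform limits of holomorphic functions are holomorphic. -/
theorem differentiableAt_of_tendstoUniformlyOn {F : ℕ → E → ℂ} {f : E → ℂ} {x : E} {r : ℝ}
    (hr : 0 < r) (hF : ∀ n, DifferentiableOn ℂ (F n) (ball x r))
    (h : TendstoUniformlyOn F f atTop (ball x r)) : DifferentiableAt ℂ f x := by
  have hsub : ∀ z ∈ ball x (r / 2), ball z (r / 2) ⊆ ball x r := fun z hz =>
    ball_subset_ball' (by rw [mem_ball] at hz; linarith)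
  have hdiff : ∀ n, ∀ z ∈ ball x r, DifferentiableAt ℂ (F n) z := fun n z hz =>
    (hF n).differentiableAt (isOpen_ball.mem_nhds hz)
  have hle : ball x (r / 2) ⊆ ball x r := ball_subset_ball (by linarith)
  -- Cauchy estimates on balls of radius r/2 about points of the half-sized ball turn uniform
  -- smallness of the functions into uniform smallness of their derivatives.
  have hC : UniformCauchySeqOn (fun n => fderiv ℂ (F n)) atTop (ball x (r / 2)) := by
    have h0 := h.uniformCauchySeqOn
    rw [Metric.uniformCauchySeqOn_iff] at h0 ⊢
    intro ε hε
    obtain ⟨N, hN⟩ := h0 (ε * r / 8) (by positivity)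
    refine ⟨N, fun m hm n hn z hz => ?_⟩
    have h1 : ‖fderiv ℂ (fun y => F m y - F n y) z‖ ≤ 2 * (ε * r / 8) / (r / 2) := by
      refine norm_fderiv_le_of_norm_le (half_pos hr)
        (((hF m).sub (hF n)).mono (hsub z hz)) fun y hy => ?_
      have := hN m hm n hn y (hsub z hz hy)
      rw [dist_eq_norm] at this
      exact this.le
    rw [fderiv_fun_sub (hdiff m z (hle hz)) (hdiff n z (hle hz)), ← dist_eq_norm] at h1
    have h2 : 2 * (ε * r / 8) / (r / 2) = ε / 2 := by field_simp; ring
    linarith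
  have hlim : ∀ z ∈ ball x (r / 2), ∃ L, Tendsto (fun n => fderiv ℂ (F n) z) atTop (𝓝 L) :=
    fun z hz => cauchySeq_tendsto_of_complete (hC.cauchySeq hz)
  choose! G hG using hlim
  have hU := hC.tendstoUniformlyOn_of_tendsto hG
  exact (hasFDerivAt_of_tendstoUniformlyOn isOpen_ball hU
    (fun n z hz => (hdiff n z (hle hz)).hasFDerivAt)
    (fun z hz => h.tendsto_at (hle hz)) (mem_ball_self (half_pos hr))).differentiableAt

/-- Second order Taylor estimate for a bounded holomorphic function. -/
theorem norm_sub_fderiv_le {f : E → ℂ} {z w : E} {R M : ℝ} (hR : 0 < R)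
    (hf : DifferentiableOn ℂ f (ball z R)) (hM : ∀ y ∈ ball z R, ‖f y‖ ≤ M) (hw : w ∈ ball z R) :
    ‖f w - f z - fderiv ℂ f z (w - z)‖ ≤ 4 * M * (‖w - z‖ / R) ^ 2 := by
  -- Without its linear part, f - f(z) vanishes to higher than first order, so the higher-order
  -- Schwarz lemma gives a quadratic bound. The constant is 4M = M + 2M + M, bounding f, its
  -- differential on the ball, and f(z).
  have hz : DifferentiableAt ℂ f z := hf.differentiableAt (ball_mem_nhds _ hR)
  have key := Complex.dist_le_mul_div_pow_of_mapsTo_ball_of_isLittleO (n := 1) (R₂ := 4 * M)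
    (f := fun y => f y - fderiv ℂ f z (y - z)) (c := z) (z := w) (R₁ := R) ?_ ?_ ?_ hw
  · simp only [sub_self, map_zero, sub_zero, dist_eq_norm] at key
    rw [sub_right_comm]
    exact key
  · exact hf.sub (by fun_prop)
  · intro y hy
    simp only [sub_self, map_zero, sub_zero, mem_closedBall, dist_eq_norm]
    have h1 := norm_fderiv_le_of_norm_le hR hf hM
    have h2 := (fderiv ℂ f z).le_opNorm (y - z)
    have h3 : ‖fderiv ℂ f z‖ * ‖y - z‖ ≤ 2 * M / R * R := by
      rw [mem_ball, dist_eq_norm] at hy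
      exact mul_le_mul h1 hy.le (norm_nonneg _) ((norm_nonneg _).trans h1)
    rw [div_mul_cancel₀ _ hR.ne'] at h3
    have h4 := norm_sub_le (f y - fderiv ℂ f z (y - z)) (f z)
    have h5 := norm_sub_le (f y) (fderiv ℂ f z (y - z))
    linarith [hM y hy, hM z (mem_ball_self hR)]
  · have := hz.hasFDerivAt.isLittleO
    simp only [sub_self, map_zero, sub_zero, pow_one]
    refine (this.congr_left fun y => ?_).norm_right
    ring

/-- Directional derivatives of holomorphic functions are holomorphic. -/
theorem differentiableOn_fderiv_apply {f : E → ℂ} {U : Set E} (hU : IsOpen U)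
    (hf : DifferentiableOn ℂ f U) (v : E) :
    DifferentiableOn ℂ (fun z => fderiv ℂ f z v) U := by
  intro x hx
  refine DifferentiableAt.differentiableWithinAt ?_
  obtain ⟨s, hs, hsM⟩ : ∃ s > 0, ball x s ⊆ U ∩ {y | ‖f y‖ ≤ ‖f x‖ + 1} := by
    refine Metric.mem_nhds_iff.1 (inter_mem (hU.mem_nhds hx) ?_)
    have : ContinuousAt (fun y => ‖f y‖) x :=
      (hf.differentiableAt (hU.mem_nhds hx)).continuousAt.norm
    filter_upwards [this.eventually (gt_mem_nhds (lt_add_one _))] with y hy using hy.le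
  set M := ‖f x‖ + 1
  -- A third suffices: if z is within r of x, the ball of radius 2r about z, where the Taylor
  -- estimate is used, stays in `ball x s`.
  set r := s / 3 with hr
  have hrpos : 0 < r := by positivity
  have hfb : DifferentiableOn ℂ f (ball x s) := hf.mono fun y hy => (hsM hy).1
  -- Step sizes of difference quotients, which converge uniformly to the directional derivative by
  -- the Taylor estimate. Every increment h·v is shorter than r; the summand 1 added to ‖v‖ also
  -- covers v = 0.
  let h : ℕ → ℝ := fun n => r / ((‖v‖ + 1) * (n + 1))
  have hpos : ∀ n, 0 < h n := fun n => by positivity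
  have hh : Tendsto h atTop (𝓝 0) := by
    have h1 := (tendsto_one_div_add_atTop_nhds_zero_nat (𝕜 := ℝ)).const_mul (r / (‖v‖ + 1))
    rw [mul_zero] at h1
    refine h1.congr fun n => ?_
    simp only [h]
    field_simp
  have hhv : ∀ n, ‖((h n : ℝ) : ℂ) • v‖ < r := fun n => by
    rw [norm_smul, Complex.norm_real, Real.norm_of_nonneg (hpos n).le]
    have h1 : h n ≤ r / (‖v‖ + 1) := by
      simp only [h]
      gcongr
      have : (0 : ℝ) ≤ n := n.cast_nonneg
      nlinarith [norm_nonneg v]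
    calc h n * ‖v‖ ≤ r / (‖v‖ + 1) * ‖v‖ := by gcongr
      _ < r := by
        rw [div_mul_eq_mul_div, div_lt_iff₀ (by positivity)]
        nlinarith [norm_nonneg v]
  refine differentiableAt_of_tendstoUniformlyOn hrpos
    (F := fun n z => ((h n : ℝ) : ℂ)⁻¹ * (f (z + ((h n : ℝ) : ℂ) • v) - f z)) (fun n => ?_) ?_
  · refine DifferentiableOn.const_mul (DifferentiableOn.sub ?_ ?_) _
    · refine hfb.comp (by fun_prop) fun z hz => ?_
      rw [mem_ball, dist_eq_norm] at hz ⊢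
      have := norm_add_le (z - x) (((h n : ℝ) : ℂ) • v)
      rw [show z + ((h n : ℝ) : ℂ) • v - x = z - x + ((h n : ℝ) : ℂ) • v by abel]
      linarith [hhv n]
    · exact hfb.mono (ball_subset_ball (by linarith))
  · rw [Metric.tendstoUniformlyOn_iff]
    intro ε hε
    have hlim : Tendsto (fun n => h n * (M * ‖v‖ ^ 2 / r ^ 2)) atTop (𝓝 0) := by
      simpa using hh.mul_const (M * ‖v‖ ^ 2 / r ^ 2)
    filter_upwards [hlim.eventually (gt_mem_nhds hε)] with n hn z hz
    have hsub : ball z (2 * r) ⊆ ball x s := ball_subset_ball' (by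
      rw [mem_ball] at hz; linarith)
    have hw : z + ((h n : ℝ) : ℂ) • v ∈ ball z (2 * r) := by
      rw [mem_ball, dist_eq_norm, add_sub_cancel_left]; linarith [hhv n]
    have key := norm_sub_fderiv_le (by positivity) (hfb.mono hsub)
      (fun y hy => (hsM (hsub hy)).2) hw
    rw [add_sub_cancel_left, map_smul, norm_smul, Complex.norm_real,
      Real.norm_of_nonneg (hpos n).le] at key
    rw [dist_comm, dist_eq_norm]
    have hne : ((h n : ℝ) : ℂ) ≠ 0 := by exact_mod_cast (hpos n).ne'
    have e : ((h n : ℝ) : ℂ)⁻¹ * (f (z + ((h n : ℝ) : ℂ) • v) - f z) - fderiv ℂ f z v =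
        ((h n : ℝ) : ℂ)⁻¹ * (f (z + ((h n : ℝ) : ℂ) • v) - f z
          - ((h n : ℝ) : ℂ) • fderiv ℂ f z v) := by
      rw [smul_eq_mul, mul_sub _ _ (((h n : ℝ) : ℂ) * _), inv_mul_cancel_left₀ hne]
    rw [e, norm_mul, norm_inv, Complex.norm_real, Real.norm_of_nonneg (hpos n).le]
    refine lt_of_le_of_lt ?_ hn
    rw [inv_mul_le_iff₀ (hpos n)]
    refine key.trans (le_of_eq ?_)
    field_simp
    ring

/-- The identity theorem for holomorphic functions on normed spaces. -/
theorem eqOn_zero_of_eventuallyEq {f : E → ℂ} {U : Set E} (hU : IsOpen U) (hc : IsPreconnected U)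
    (hf : DifferentiableOn ℂ f U) {x : E} (hx : x ∈ U) (h0 : f =ᶠ[𝓝 x] 0) : EqOn f 0 U := by
  have hsub : U ⊆ {z | f =ᶠ[𝓝 z] 0} := by
    refine hc.subset_of_closure_inter_subset isOpen_setOfPred_eventually_nhds ⟨x, hx, h0⟩ ?_
    rintro p ⟨hpc, hpU⟩
    obtain ⟨r, hr, hrU⟩ := Metric.isOpen_iff.1 hU p hpU
    obtain ⟨q, hq, hqr⟩ := Metric.mem_closure_iff.1 hpc r hr
    have hqb : q ∈ ball p r := by rwa [mem_ball, dist_comm]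
    filter_upwards [ball_mem_nhds p hr] with z hz
    -- The points near which f vanishes form an open set. That it is relatively closed follows from
    -- the one-variable identity theorem on complex lines through a nearby point q of the set.
    let l : ℂ → E := fun t => q + t • (z - q)
    have hl : Differentiable ℂ l := by fun_prop
    have hopen : IsOpen (l ⁻¹' ball p r) := isOpen_ball.preimage hl.continuous
    have hconv : Convex ℝ (l ⁻¹' ball p r) := by
      intro a ha b hb s t hs ht hst
      have e : l (s • a + t • b) = s • l a + t • l b := by
        simp only [l, smul_add, add_smul, smul_assoc]
        nth_rewrite 1 [← one_smul ℝ q]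
        rw [← hst, add_smul]
        abel
      change l (s • a + t • b) ∈ ball p r
      rw [e]
      exact convex_ball p r ha hb hs ht hst
    have han : AnalyticOnNhd ℂ (f ∘ l) (l ⁻¹' ball p r) :=
      ((hf.mono hrU).comp hl.differentiableOn fun t ht => ht).analyticOnNhd hopen
    have hz0 : (0 : ℂ) ∈ l ⁻¹' ball p r := by simpa [l] using hqb
    have hev : f ∘ l =ᶠ[𝓝 0] 0 := by
      have : Tendsto l (𝓝 0) (𝓝 q) := by
        have := hl.continuous.tendsto 0
        simpa [l] using this
      exact this.eventually hq
    have h1 : (1 : ℂ) ∈ l ⁻¹' ball p r := by simpa [l] using hz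
    have := han.eqOn_zero_of_preconnected_of_eventuallyEq_zero hconv.isPreconnected hz0 hev h1
    simpa [l] using this
  exact fun z hz => (hsub hz).self_of_nhds

end Holomorphic

/-! ### Mean value property on polydiscs. -/

section MeanValue

variable {n : ℕ}

theorem measurePreserving_diagonal {c : Fin n → ℂ} (hc : ∀ i, ‖c i‖ = 1) :
    MeasurePreserving (fun (z : Fin n → ℂ) i => c i * z i) := by
  refine volume_preserving_pi fun i => ?_
  exact (rotation (⟨c i, by simpa [Submonoid.unitSphere] using hc i⟩ : Circle)).measurePreserving

/-- The mean value property of holomorphic functions on polydiscs. -/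
theorem setIntegral_closedBall_eq {f : (Fin n → ℂ) → ℂ} {U : Set (Fin n → ℂ)}
    (hf : DifferentiableOn ℂ f U) {w : Fin n → ℂ} {r : ℝ} (hr : closedBall w r ⊆ U) :
    ∫ z in closedBall w r, f z = volume.real (closedBall w r) * f w := by
  set B : Set (Fin n → ℂ) := closedBall 0 r with hB
  have hmem : ∀ u ∈ B, ∀ c : ℂ, ‖c‖ ≤ 1 → w + c • u ∈ closedBall w r := by
    intro u hu c hc
    rw [hB, mem_closedBall_zero_iff] at hu
    rw [mem_closedBall, dist_eq_norm, add_sub_cancel_left, norm_smul]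
    nlinarith [norm_nonneg u, norm_nonneg c]
  -- The integral is unchanged by a unimodular rotation about w. Averaging over c and exchanging the
  -- integrals leaves circle averages of c ↦ f(w + c•u), each equal to f(w).
  have h1 : ∀ c : ℂ, ‖c‖ = 1 → ∫ z in closedBall w r, f z = ∫ u in B, f (w + c • u) := by
    intro c hc
    have hm := (measurePreserving_add_left volume w).comp
      (measurePreserving_diagonal (c := fun _ : Fin n => c) (fun _ => hc))
    have he : MeasurableEmbedding ((fun z => w + z) ∘ fun (z : Fin n → ℂ) i => c * z i) := by
      refine (measurableEmbedding_addLeft w).comp ?_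
      have hc0 : c ≠ 0 := by rw [← norm_ne_zero_iff, hc]; exact one_ne_zero
      exact measurableEmbedding_const_smul₀ hc0
    have hpre : ((fun z => w + z) ∘ fun (z : Fin n → ℂ) i => c * z i) ⁻¹' closedBall w r = B := by
      ext u
      have e : (fun i => c * u i) = c • u := rfl
      simp [hB, e, norm_smul, hc]
    rw [← hm.setIntegral_preimage_emb he, hpre]
    rfl
  have hcont : ContinuousOn (fun p : ℝ × (Fin n → ℂ) => f (w + circleMap 0 1 p.1 • p.2))
      (Icc 0 (2 * Real.pi) ×ˢ B) := by
    refine hf.continuousOn.comp (by fun_prop) fun p hp => hr (hmem _ hp.2 _ (by simp))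
  have hint := hcont.integrableOn_compact (μ := volume.prod volume)
    (isCompact_Icc.prod (isCompact_closedBall _ _))
  rw [IntegrableOn, ← Measure.prod_restrict] at hint
  have hswap := integral_integral_swap
    (f := fun (t : ℝ) (u : Fin n → ℂ) => f (w + circleMap 0 1 t • u)) hint
  have hL : ∫ t in Icc 0 (2 * Real.pi), ∫ u in B, f (w + circleMap 0 1 t • u) =
      (2 * Real.pi : ℝ) * ∫ z in closedBall w r, f z := by
    rw [setIntegral_congr_fun measurableSet_Icc
      (g := fun _ => ∫ z in closedBall w r, f z) fun t _ => (h1 _ (by simp)).symm]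
    simp [Real.pi_pos.le]
  have hRt : ∫ u in B, ∫ t in Icc 0 (2 * Real.pi), f (w + circleMap 0 1 t • u) =
      ∫ u in B, (2 * Real.pi : ℝ) * f w := by
    refine setIntegral_congr_fun isClosed_closedBall.measurableSet fun u hu => ?_
    have hd : DiffContOnCl ℂ (fun c : ℂ => f (w + c • u)) (ball 0 |1|) := by
      refine DifferentiableOn.diffContOnCl ?_
      refine hf.comp (by fun_prop) fun c hc => hr (hmem u hu c ?_)
      simpa using closure_ball_subset_closedBall hc
    have := hd.circleAverage
    rw [Real.circleAverage_def, intervalIntegral.integral_of_le Real.two_pi_pos.le,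
      ← integral_Icc_eq_integral_Ioc] at this
    simp only [zero_smul, add_zero] at this
    rw [← this]
    have hpi : ((2 * Real.pi : ℝ) : ℂ) ≠ 0 := by exact_mod_cast Real.two_pi_pos.ne'
    simp only [Complex.real_smul, Complex.ofReal_inv]
    rw [mul_inv_cancel_left₀ hpi]
  rw [hL, hRt, setIntegral_const, Complex.real_smul] at hswap
  have hpi : ((2 * Real.pi : ℝ) : ℂ) ≠ 0 := by exact_mod_cast Real.two_pi_pos.ne'
  have hvol : volume.real (closedBall w r) = volume.real B := by
    simp [hB, measureReal_def, Measure.addHaar_closedBall_center]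
  rw [hvol]
  exact mul_left_cancel₀ hpi (hswap.trans (by ring))

end MeanValue

end QuasiReinhardt

namespace QuasiReinhardt

open Metric Set Filter Topology MvPolynomial

/-! ### Characters, weights and finiteness of resonances. -/

section Character

variable {n r : ℕ}

/-- The character `λ ↦ λ^μ = ∏ j, λ_j ^ μ_j` of the torus. -/
def character (μ : Fin r → ℤ) (lam : Fin r → Circle) : ℂ := ∏ j, (lam j : ℂ) ^ μ j

theorem torusAction_apply (m : Fin n → Fin r → ℤ) (lam : Fin r → Circle) (z : Fin n → ℂ)
    (i : Fin n) : torusAction m lam z i = character (m i) lam * z i := rfl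

@[simp]
theorem norm_character (μ : Fin r → ℤ) (lam : Fin r → Circle) : ‖character μ lam‖ = 1 := by
  rw [character, norm_prod]
  exact Finset.prod_eq_one fun j _ => by rw [norm_zpow, Circle.norm_coe, one_zpow]

theorem character_ne_zero (μ : Fin r → ℤ) (lam : Fin r → Circle) : character μ lam ≠ 0 := by
  rw [← norm_ne_zero_iff, norm_character]; exact one_ne_zero

theorem character_add (μ ν : Fin r → ℤ) (lam : Fin r → Circle) :
    character (μ + ν) lam = character μ lam * character ν lam := by
  simp [character, zpow_add₀, Finset.prod_mul_distrib]

theorem character_zero (lam : Fin r → Circle) : character 0 lam = 1 := by simp [character]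

theorem character_nsmul (k : ℕ) (μ : Fin r → ℤ) (lam : Fin r → Circle) :
    character (k • μ) lam = character μ lam ^ k := by
  simp [character, zpow_mul', Finset.prod_pow]

theorem character_sum {ι : Type*} (s : Finset ι) (μ : ι → Fin r → ℤ) (lam : Fin r → Circle) :
    character (∑ i ∈ s, μ i) lam = ∏ i ∈ s, character (μ i) lam := by
  classical
  induction s using Finset.induction_on with
  | empty => simp [character_zero]
  | insert a s ha ih => rw [Finset.sum_insert ha, Finset.prod_insert ha, character_add, ih]

theorem character_sub (μ ν : Fin r → ℤ) (lam : Fin r → Circle) :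
    character (μ - ν) lam = character μ lam / character ν lam := by
  rw [eq_div_iff (character_ne_zero _ _), ← character_add, sub_add_cancel]

theorem character_inv (μ : Fin r → ℤ) (lam : Fin r → Circle) :
    character μ lam⁻¹ = (character μ lam)⁻¹ := by
  simp [character]

theorem exists_character_ne_one {μ : Fin r → ℤ} (hμ : μ ≠ 0) : ∃ lam, character μ lam ≠ 1 := by
  obtain ⟨j, hj⟩ := Function.ne_iff.1 hμ
  -- With this choice the character takes the value exp(iπ) = -1.
  refine ⟨Function.update 1 j (Circle.exp (Real.pi / μ j)), ?_⟩
  have hj' : (μ j : ℂ) ≠ 0 := by exact_mod_cast hj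
  rw [character, Finset.prod_eq_single j]
  · rw [Function.update_self, Circle.coe_exp, ← Complex.exp_int_mul]
    have : (μ j : ℂ) * ((Real.pi / μ j : ℝ) * Complex.I) = Real.pi * Complex.I := by
      push_cast; field_simp
    rw [this, Complex.exp_pi_mul_I]
    norm_num
  · intro b _ hb
    simp [Function.update_of_ne hb]
  · simp

/-- The torus action as a continuous linear map. -/
def torusCLM (m : Fin n → Fin r → ℤ) (lam : Fin r → Circle) : (Fin n → ℂ) →L[ℂ] (Fin n → ℂ) :=
  ContinuousLinearMap.pi fun i => character (m i) lam • ContinuousLinearMap.proj i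

theorem torusCLM_apply (m : Fin n → Fin r → ℤ) (lam : Fin r → Circle) (z : Fin n → ℂ) :
    torusCLM m lam z = torusAction m lam z := rfl

theorem torusAction_zero (m : Fin n → Fin r → ℤ) (lam : Fin r → Circle) :
    torusAction m lam 0 = 0 := by
  rw [← torusCLM_apply, map_zero]

theorem torusAction_inv (m : Fin n → Fin r → ℤ) (lam : Fin r → Circle) (z : Fin n → ℂ) :
    torusAction m lam⁻¹ (torusAction m lam z) = z := by
  ext i
  rw [torusAction_apply, torusAction_apply, character_inv,
    inv_mul_cancel_left₀ (character_ne_zero _ _)]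

theorem torusCLM_single (m : Fin n → Fin r → ℤ) (lam : Fin r → Circle) (k : Fin n) :
    torusCLM m lam (Pi.single k 1) = character (m k) lam • Pi.single k 1 := by
  ext i
  rw [torusCLM_apply, torusAction_apply]
  by_cases h : i = k
  · subst h; simp
  · simp [h]

/-- `f` transforms under the torus action on `D` by the character of weight `μ`. -/
def IsSemiInvariant (m : Fin n → Fin r → ℤ) (D : Set (Fin n → ℂ)) (μ : Fin r → ℤ)
    (f : (Fin n → ℂ) → ℂ) : Prop :=
  ∀ lam, ∀ z ∈ D, f (torusAction m lam z) = character μ lam * f z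

theorem weight_eq (m : Fin n → Fin r → ℤ) (α : Fin n →₀ ℕ) :
    Finsupp.weight m α = ∑ l, α l • m l := by
  rw [Finsupp.weight_apply, Finsupp.sum_fintype]
  simp

theorem mem_resonanceSet_iff (m : Fin n → Fin r → ℤ) (i : Fin n) (α : Fin n →₀ ℕ) :
    α ∈ resonanceSet m i ↔ Finsupp.weight m α = m i := by
  rw [weight_eq, funext_iff]
  simp [resonanceSet]

/-- If all invariant entire functions are constant, no nonconstant monomial is invariant. -/
theorem eq_zero_of_weight_eq_zero {m : Fin n → Fin r → ℤ} (hm : OnlyConstantInvariants m)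
    {α : Fin n →₀ ℕ} (hα : Finsupp.weight m α = 0) : α = 0 := by
  obtain ⟨c, hc⟩ := hm (fun z => ∏ l, z l ^ α l) (by fun_prop) fun lam z => by
    have : ∏ l, character (m l) lam ^ α l = 1 := by
      rw [← character_zero lam, ← hα, weight_eq, character_sum]
      simp_rw [character_nsmul]
    simp_rw [torusAction_apply, mul_pow, Finset.prod_mul_distrib, this, one_mul]
  -- The invariant monomial is constant; it equals 1 at (1,…,1), and 0 at the origin if some
  -- exponent is nonzero.
  have h1 : c = 1 := by simpa using (hc 1).symm
  by_contra hne
  obtain ⟨l, hl⟩ := Finsupp.ne_iff.1 hne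
  have h0 := hc 0
  rw [h1, Finset.prod_eq_zero (Finset.mem_univ l)] at h0
  · exact zero_ne_one h0
  · simpa using hl

/-- Two comparable exponents of equal weight differ by an exponent of weight zero, hence coincide.
Antichains in ℕⁿ are finite by Dickson's lemma. -/
theorem finite_setOf_weight_eq {m : Fin n → Fin r → ℤ} (hm : OnlyConstantInvariants m)
    (μ : Fin r → ℤ) : {α : Fin n →₀ ℕ | Finsupp.weight m α = μ}.Finite := by
  refine IsAntichain.finite_of_partiallyWellOrderedOn (r := (· ≤ ·)) ?_
    (isPWO_of_wellQuasiOrderedLE _)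
  intro α hα β hβ hne hle
  obtain ⟨γ, rfl⟩ := exists_add_of_le hle
  refine hne ?_
  rw [mem_ofPred_eq] at hα hβ
  rw [map_add, hα, add_eq_left] at hβ
  rw [eq_zero_of_weight_eq_zero hm hβ, add_zero]

end Character

/-! ### Derivatives of polynomials at the origin. -/

section PolynomialDeriv

variable {n : ℕ}

theorem differentiable_eval (P : MvPolynomial (Fin n) ℂ) :
    Differentiable ℂ fun z : Fin n → ℂ => eval z P := by
  induction P using MvPolynomial.induction_on with
  | C a => simp
  | add p q hp hq =>
    simp only [eval_add]
    exact hp.add hq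
  | mul_X p i hp =>
    simp only [eval_mul, eval_X]
    exact hp.mul (differentiable_apply i)

theorem fderiv_eval_zero (P : MvPolynomial (Fin n) ℂ) (k : Fin n) :
    fderiv ℂ (fun z : Fin n → ℂ => eval z P) 0 (Pi.single k 1) =
      coeff (Finsupp.single k 1) P := by
  classical
  induction P using MvPolynomial.induction_on with
  | C a =>
    simp only [eval_C, fderiv_fun_const, coeff_C]
    rw [if_neg]
    · rfl
    · intro h
      have := congrArg (fun α => α k) h
      simp at this
  | add p q hp hq =>
    simp only [eval_add, coeff_add]
    rw [fderiv_fun_add (differentiable_eval p 0) (differentiable_eval q 0), ← hp, ← hq]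
    rfl
  | mul_X p i hp =>
    simp only [eval_mul, eval_X]
    rw [fderiv_fun_mul (differentiable_eval p 0) (differentiableAt_apply i 0), coeff_mul_X']
    have e : fderiv ℂ (fun z : Fin n → ℂ => z i) 0 (Pi.single k 1) = if i = k then 1 else 0 := by
      have := (hasFDerivAt_apply (𝕜 := ℂ) i (0 : Fin n → ℂ)).fderiv
      rw [this]
      simp [Pi.single_apply]
    simp only [add_apply, smul_apply, e, Pi.zero_apply, smul_eq_mul, mul_ite, mul_one, mul_zero,
      zero_mul, add_zero, Finsupp.support_single k one_ne_zero, Finset.mem_singleton]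
    by_cases h : i = k
    · subst h
      rw [if_pos rfl, if_pos rfl, tsub_self, ← constantCoeff_eq, ← eval_zero]
    · rw [if_neg h, if_neg h]

end PolynomialDeriv

/-! ### Semi-invariant holomorphic functions are polynomials. -/

section Taylor

variable {n r : ℕ} {m : Fin n → Fin r → ℤ} {D : Set (Fin n → ℂ)}

theorem eq_zero_of_isSemiInvariant {μ : Fin r → ℤ} {f : (Fin n → ℂ) → ℂ}
    (h0 : (0 : Fin n → ℂ) ∈ D) (hf : IsSemiInvariant m D μ f) (hμ : μ ≠ 0) : f 0 = 0 := by
  obtain ⟨lam, hlam⟩ := exists_character_ne_one hμ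
  have := hf lam 0 h0
  rw [torusAction_zero] at this
  by_contra hne
  exact hlam (mul_right_cancel₀ hne (by rw [one_mul]; exact this.symm))

/-- Differentiating the semi-invariance identity along e_k produces a factor λ^{m_k} on the left, so
the weight drops by m_k. -/
theorem IsSemiInvariant.fderiv_apply {μ : Fin r → ℤ} {f : (Fin n → ℂ) → ℂ} (hD : IsOpen D)
    (hinv : ∀ (lam : Fin r → Circle), ∀ z ∈ D, torusAction m lam z ∈ D)
    (hd : DifferentiableOn ℂ f D) (hf : IsSemiInvariant m D μ f) (k : Fin n) :
    IsSemiInvariant m D (μ - m k) fun z => fderiv ℂ f z (Pi.single k 1) := by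
  intro lam z hz
  have h1 : HasFDerivAt (fun y => f (torusAction m lam y))
      ((fderiv ℂ f (torusAction m lam z)).comp (torusCLM m lam)) z :=
    HasFDerivAt.comp z
      (hd.differentiableAt (hD.mem_nhds (hinv lam z hz))).hasFDerivAt (torusCLM m lam).hasFDerivAt
  have h2 : HasFDerivAt (fun y => f (torusAction m lam y))
      (character μ lam • fderiv ℂ f z) z := by
    refine ((hd.differentiableAt (hD.mem_nhds hz)).hasFDerivAt.const_mul
      (character μ lam)).congr_of_eventuallyEq ?_
    filter_upwards [hD.mem_nhds hz] with y hy using hf lam y hy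
  have h3 := congrArg (fun L => L (Pi.single k 1)) (h1.unique h2)
  simp only [ContinuousLinearMap.comp_apply, torusCLM_single, map_smul,
    smul_apply, smul_eq_mul] at h3
  rw [character_sub, div_mul_eq_mul_div, eq_div_iff (character_ne_zero _ _), mul_comm]
  exact h3

/-- The homogeneous Taylor coefficients at the origin of a semi-invariant holomorphic function
are weighted homogeneous polynomials. -/
theorem exists_eval_eq_iteratedDeriv (hD : IsOpen D) (h0 : (0 : Fin n → ℂ) ∈ D)
    (hinv : ∀ (lam : Fin r → Circle), ∀ z ∈ D, torusAction m lam z ∈ D) (d : ℕ)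
    {μ : Fin r → ℤ} {f : (Fin n → ℂ) → ℂ}
    (hd : DifferentiableOn ℂ f D) (hf : IsSemiInvariant m D μ f) :
    ∃ P : MvPolynomial (Fin n) ℂ, IsWeightedHomogeneous m P μ ∧ P.IsHomogeneous d ∧
      ∀ z, iteratedDeriv d (fun t : ℂ => f (t • z)) 0 = eval z P := by
  induction d generalizing μ f with
  | zero =>
    refine ⟨C (f 0), ?_, isHomogeneous_C _ _, fun z => by simp⟩
    by_cases hμ : μ = 0
    · rw [hμ]; exact isWeightedHomogeneous_C _ _
    · rw [eq_zero_of_isSemiInvariant h0 hf hμ, C_0]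
      exact isWeightedHomogeneous_zero _ _ _
  | succ d ih =>
    choose P hP1 hP2 hP3 using fun k : Fin n =>
      ih (differentiableOn_fderiv_apply hD hd (Pi.single k 1)) (hf.fderiv_apply hD hinv hd k)
    -- This is d/dt f(tz) = ∑ z_k (∂_k f)(tz); multiplication by X_k restores the weight m_k lost in
    -- differentiating.
    refine ⟨∑ k, X k * P k, ?_, ?_, fun z => ?_⟩
    · refine IsWeightedHomogeneous.sum _ _ _ fun k _ => ?_
      have := (isWeightedHomogeneous_X ℂ m k).mul (hP1 k)
      rwa [add_sub_cancel] at this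
    · refine IsHomogeneous.sum _ _ _ fun k _ => ?_
      rw [add_comm]
      exact (isHomogeneous_X ℂ k).mul (hP2 k)
    · have hc : Continuous fun t : ℂ => t • z := by fun_prop
      have hopen : IsOpen ((fun t : ℂ => t • z) ⁻¹' D) := hD.preimage hc
      have hmem : (0 : ℂ) ∈ (fun t : ℂ => t • z) ⁻¹' D := by simpa using h0
      have hev : deriv (fun t : ℂ => f (t • z)) =ᶠ[𝓝 0]
          fun t => ∑ k, z k * fderiv ℂ f (t • z) (Pi.single k 1) := by
        filter_upwards [hopen.mem_nhds hmem] with t ht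
        have h1 : HasDerivAt (fun t : ℂ => t • z) z t := by
          simpa using (hasDerivAt_id t).smul_const z
        have h2 := ((hd.differentiableAt (hD.mem_nhds ht)).hasFDerivAt.comp_hasDerivAt t h1).deriv
        change deriv (f ∘ fun t : ℂ => t • z) t = _
        rw [h2]
        generalize fderiv ℂ f (t • z) = L
        conv_lhs => rw [pi_eq_sum_univ' z]
        simp only [map_sum, map_smul, smul_eq_mul]
      rw [iteratedDeriv_succ', hev.iteratedDeriv_eq, iteratedDeriv_fun_sum]
      · simp only [map_sum, eval_mul, eval_X]
        refine Finset.sum_congr rfl fun k _ => ?_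
        rw [iteratedDeriv_const_mul_field, hP3]
      · intro k _
        have : DifferentiableOn ℂ (fun t : ℂ => z k * fderiv ℂ f (t • z) (Pi.single k 1))
            ((fun t : ℂ => t • z) ⁻¹' D) :=
          DifferentiableOn.const_mul ((differentiableOn_fderiv_apply hD hd (Pi.single k 1)).comp
            (f := fun t : ℂ => t • z) (by fun_prop) fun t ht => ht) _
        exact (this.analyticAt (hopen.mem_nhds hmem)).contDiffAt

/-- Semi-invariant holomorphic functions are weighted homogeneous polynomials. -/
theorem exists_eval_eq (hD : IsOpen D) (hconn : IsPreconnected D) (h0 : (0 : Fin n → ℂ) ∈ D)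
    (hinv : ∀ (lam : Fin r → Circle), ∀ z ∈ D, torusAction m lam z ∈ D)
    (hm : OnlyConstantInvariants m) {μ : Fin r → ℤ} {f : (Fin n → ℂ) → ℂ}
    (hd : DifferentiableOn ℂ f D) (hf : IsSemiInvariant m D μ f) :
    ∃ P : MvPolynomial (Fin n) ℂ, IsWeightedHomogeneous m P μ ∧ ∀ z ∈ D, f z = eval z P := by
  choose P hP1 hP2 hP3 using fun d => exists_eval_eq_iteratedDeriv hD h0 hinv d hd hf
  obtain ⟨N, hN⟩ := ((finite_setOf_weight_eq hm μ).image Finsupp.degree).bddAbove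
  have hzero : ∀ d, d ∉ Finset.range (N + 1) → P d = 0 := by
    intro d hdN
    rw [Finset.mem_range, not_lt] at hdN
    ext α
    rw [coeff_zero]
    by_contra hne
    have h1 : α.degree = d := by
      rw [Finsupp.degree_eq_weight_one]; exact hP2 d hne
    have := hN ⟨α, hP1 d hne, rfl⟩
    omega
  refine ⟨∑ d ∈ Finset.range (N + 1), C (d.factorial : ℂ)⁻¹ * P d,
    IsWeightedHomogeneous.sum _ _ _ fun d _ => (hP1 d).C_mul _, ?_⟩
  set Q := ∑ d ∈ Finset.range (N + 1), C (d.factorial : ℂ)⁻¹ * P d with hQ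
  have key := eqOn_zero_of_eventuallyEq hD hconn (hd.sub (differentiable_eval Q).differentiableOn)
    h0 ?_
  · exact fun z hz => sub_eq_zero.1 (key hz)
  obtain ⟨R, hR, hRD⟩ := Metric.isOpen_iff.1 hD 0 h0
  -- Half the radius makes t ↦ f(t•z) holomorphic on the disc of radius 2, so its Taylor series can
  -- be summed at t = 1.
  filter_upwards [ball_mem_nhds (0 : Fin n → ℂ) (half_pos hR)] with z hz
  have hg : DifferentiableOn ℂ (fun t : ℂ => f (t • z)) (ball 0 2) := by
    refine hd.comp (by fun_prop) fun t ht => hRD ?_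
    rw [mem_ball_zero_iff] at hz ht ⊢
    rw [norm_smul]
    nlinarith [norm_nonneg z, norm_nonneg t]
  have hs := Complex.hasSum_taylorSeries_on_ball hg (z := 1) (by simp)
  simp only [sub_zero, one_pow, one_smul, hP3, smul_eq_mul, one_mul] at hs
  have hs' : HasSum (fun d : ℕ => (d.factorial : ℂ)⁻¹ * eval z (P d))
      (∑ d ∈ Finset.range (N + 1), (d.factorial : ℂ)⁻¹ * eval z (P d)) :=
    hasSum_sum_of_ne_finset_zero fun d hdN => by simp [hzero d hdN]
  have := hs.unique hs'
  simp [this, hQ, map_sum]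

end Taylor

end QuasiReinhardt

namespace QuasiReinhardt

open Metric Set Filter Topology

/-! ### The Bergman space as a Hilbert space, and its kernel. -/

section BergmanSpace

variable {n : ℕ} {D : Set (Fin n → ℂ)}

theorem MemBergmanSpace.sub {f g : (Fin n → ℂ) → ℂ} (hf : MemBergmanSpace D f)
    (hg : MemBergmanSpace D g) : MemBergmanSpace D (f - g) :=
  ⟨hf.1.sub hg.1, hf.2.sub hg.2⟩

theorem MemBergmanSpace.const_smul {f : (Fin n → ℂ) → ℂ} (hf : MemBergmanSpace D f) (c : ℂ) :
    MemBergmanSpace D (c • f) :=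
  ⟨hf.1.const_smul c, hf.2.const_smul c⟩

theorem MemBergmanSpace.sum {ι : Type*} (s : Finset ι) {f : ι → (Fin n → ℂ) → ℂ}
    (hf : ∀ i ∈ s, MemBergmanSpace D (f i)) : MemBergmanSpace D (∑ i ∈ s, f i) :=
  ⟨DifferentiableOn.sum fun i hi => (hf i hi).1, memLp_finsetSum' s fun i hi => (hf i hi).2⟩

/-- The normalized indicator function of a closed polydisc, as an element of `L²(D)`. -/
def ballAverage (D : Set (Fin n → ℂ)) (w : Fin n → ℂ) (r : ℝ) : Lp ℂ 2 (volume.restrict D) :=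
  indicatorConstLp 2 (s := closedBall w r) isClosed_closedBall.measurableSet
    ((Measure.restrict_apply_le _ _).trans_lt measure_closedBall_lt_top).ne
    ((volume.real (closedBall w r) : ℂ)⁻¹)

/-- By the mean value property, point evaluation is an L² pairing. This makes it bounded on the
Bergman space. -/
theorem inner_ballAverage {f : (Fin n → ℂ) → ℂ} (hf : DifferentiableOn ℂ f D)
    {g : Lp ℂ 2 (volume.restrict D)} (hg : g =ᵐ[volume.restrict D] f) {w : Fin n → ℂ} {r : ℝ}
    (hr : 0 < r) (hw : closedBall w r ⊆ D) : inner ℂ (ballAverage D w r) g = f w := by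
  have hm : MeasurableSet (closedBall w r) := isClosed_closedBall.measurableSet
  rw [ballAverage, L2.inner_indicatorConstLp_eq_inner_setIntegral,
    Measure.restrict_restrict hm, inter_eq_left.2 hw,
    integral_congr_ae (ae_restrict_of_ae_restrict_of_subset hw hg),
    setIntegral_closedBall_eq hf hw]
  have : (volume.real (closedBall w r) : ℂ) ≠ 0 := by
    exact_mod_cast (ENNReal.toReal_pos (measure_closedBall_pos volume w hr).ne'
      measure_closedBall_lt_top.ne).ne'
  rw [RCLike.inner_apply, map_inv₀, Complex.conj_ofReal]
  field_simp

theorem exists_norm_ballAverage_le (D : Set (Fin n → ℂ)) (r : ℝ) :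
    ∃ C, ∀ w, ‖ballAverage D w r‖ ≤ C := by
  refine ⟨(volume.real (closedBall (0 : Fin n → ℂ) r))⁻¹ *
    volume.real (closedBall (0 : Fin n → ℂ) r) ^ (1 / (2 : ENNReal).toReal), fun w => ?_⟩
  have hvol : volume.real (closedBall w r) = volume.real (closedBall (0 : Fin n → ℂ) r) := by
    simp [measureReal_def, Measure.addHaar_closedBall_center]
  refine norm_indicatorConstLp_le.trans ?_
  rw [norm_inv, Complex.norm_real, Real.norm_of_nonneg measureReal_nonneg, hvol]
  gcongr
  rw [← hvol]
  exact ENNReal.toReal_mono measure_closedBall_lt_top.ne (Measure.restrict_apply_le _ _)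

/-- Point evaluations are locally uniformly bounded on the Bergman space. -/
theorem exists_norm_le_of_ball_subset (D : Set (Fin n → ℂ)) {x : Fin n → ℂ} {r : ℝ} (hr : 0 < r)
    (hD : ball x (2 * r) ⊆ D) :
    ∃ C, 0 ≤ C ∧ ∀ f, DifferentiableOn ℂ f D → ∀ g : Lp ℂ 2 (volume.restrict D),
      g =ᵐ[volume.restrict D] f → ∀ w ∈ ball x r, ‖f w‖ ≤ C * ‖g‖ := by
  obtain ⟨C, hC⟩ := exists_norm_ballAverage_le D (r / 2)
  refine ⟨C, (norm_nonneg _).trans (hC 0), fun f hf g hg w hw => ?_⟩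
  have hsub : closedBall w (r / 2) ⊆ D := by
    refine Subset.trans (fun y hy => ?_) hD
    rw [mem_closedBall] at hy
    rw [mem_ball] at hw ⊢
    linarith [dist_triangle y w x]
  rw [← inner_ballAverage hf hg (half_pos hr) hsub]
  exact (norm_inner_le_norm _ _).trans (by gcongr; exact hC w)

theorem exists_ball_subset (hD : IsOpen D) {x : Fin n → ℂ} (hx : x ∈ D) :
    ∃ r > 0, ball x (2 * r) ⊆ D := by
  obtain ⟨s, hs, h⟩ := Metric.isOpen_iff.1 hD x hx
  exact ⟨s / 2, half_pos hs, by rwa [mul_div_cancel₀ _ two_ne_zero]⟩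

variable (D) in
/-- The Bergman space as a subspace of `L²(D)`. -/
def bergmanSubmodule : Submodule ℂ (Lp ℂ 2 (volume.restrict D)) where
  carrier := {g | ∃ f, DifferentiableOn ℂ f D ∧ g =ᵐ[volume.restrict D] f}
  zero_mem' := ⟨0, differentiableOn_const 0, Lp.coeFn_zero _ _ _⟩
  add_mem' := by
    rintro a b ⟨f, hf, haf⟩ ⟨g, hg, hbg⟩
    exact ⟨f + g, hf.add hg, (Lp.coeFn_add a b).trans (haf.add hbg)⟩
  smul_mem' := by
    rintro c a ⟨f, hf, haf⟩
    exact ⟨c • f, hf.const_smul c, (Lp.coeFn_smul c a).trans (haf.const_smul c)⟩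

/-- Bounded point evaluations turn L² convergence into locally uniform convergence of the
holomorphic representatives, so their pointwise limit is holomorphic. An almost everywhere
convergent subsequence identifies it with the L² limit. -/
theorem isClosed_bergmanSubmodule (hD : IsOpen D) :
    IsClosed (bergmanSubmodule D : Set (Lp ℂ 2 (volume.restrict D))) := by
  refine isClosed_of_closure_subset fun g hg => ?_
  obtain ⟨G, hGmem, hG⟩ := mem_closure_iff_seq_limit.1 hg
  choose F hF hFG using hGmem
  have hlim : ∀ x ∈ D, ∃ l, Tendsto (fun k => F k x) atTop (𝓝 l) := by
    intro x hx
    obtain ⟨r, hr, hrD⟩ := exists_ball_subset hD hx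
    have hsub : closedBall x r ⊆ D := (closedBall_subset_ball (by linarith)).trans hrD
    refine ⟨inner ℂ (ballAverage D x r) g, ?_⟩
    exact (tendsto_const_nhds.inner hG).congr fun k => inner_ballAverage (hF k) (hFG k) hr hsub
  choose! f hf using hlim
  refine ⟨f, fun x hx => ?_, ?_⟩
  · obtain ⟨r, hr, hrD⟩ := exists_ball_subset hD hx
    obtain ⟨C, hC0, hC⟩ := exists_norm_le_of_ball_subset D hr hrD
    have hsub : ball x r ⊆ D := (ball_subset_ball (by linarith)).trans hrD
    refine (differentiableAt_of_tendstoUniformlyOn hr (fun k => (hF k).mono hsub)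
      ?_).differentiableWithinAt
    refine UniformCauchySeqOn.tendstoUniformlyOn_of_tendsto ?_ fun w hw => hf w (hsub hw)
    rw [Metric.uniformCauchySeqOn_iff]
    intro ε hε
    obtain ⟨N, hN⟩ := Metric.cauchySeq_iff.1 hG.cauchySeq (ε / (C + 1)) (by positivity)
    refine ⟨N, fun i hi j hj w hw => ?_⟩
    have h1 := hC _ ((hF i).sub (hF j)) (G i - G j)
      ((Lp.coeFn_sub _ _).trans ((hFG i).sub (hFG j))) w hw
    have h2 := hN i hi j hj
    rw [dist_eq_norm] at h2 ⊢
    rw [lt_div_iff₀ (by positivity)] at h2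
    refine lt_of_le_of_lt h1 (lt_of_le_of_lt ?_ h2)
    nlinarith [norm_nonneg (G i - G j)]
  · obtain ⟨ns, hm, hns⟩ := (tendstoInMeasure_of_tendsto_Lp hG).exists_seq_tendsto_ae
    have hmem : ∀ᵐ x ∂(volume.restrict D), x ∈ D := ae_restrict_mem hD.measurableSet
    have hall : ∀ᵐ x ∂(volume.restrict D), ∀ k, G k x = F k x := ae_all_iff.2 hFG
    filter_upwards [hns, hmem, hall] with x h1 h2 h3
    simp only [h3] at h1
    exact tendsto_nhds_unique h1 ((hf x h2).comp hm.tendsto_atTop)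

theorem MemBergmanSpace.toLp_mem {f : (Fin n → ℂ) → ℂ} (hf : MemBergmanSpace D f) :
    hf.2.toLp f ∈ bergmanSubmodule D :=
  ⟨f, hf.1, hf.2.coeFn_toLp⟩

theorem eqOn_of_ae_eq (hD : IsOpen D) {f g : (Fin n → ℂ) → ℂ} (hf : DifferentiableOn ℂ f D)
    (hg : DifferentiableOn ℂ g D) (h : f =ᵐ[volume.restrict D] g) : EqOn f g D :=
  Measure.eqOn_open_of_ae_eq h hD hf.continuousOn hg.continuousOn

/-- The Riesz representation theorem on the Bergman space. -/
theorem exists_representing (hD : IsOpen D) (L : ((Fin n → ℂ) → ℂ) → ℂ)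
    (hcongr : ∀ f g, EqOn f g D → L f = L g)
    (hadd : ∀ f g, DifferentiableOn ℂ f D → DifferentiableOn ℂ g D → L (f + g) = L f + L g)
    (hsmul : ∀ (c : ℂ) f, DifferentiableOn ℂ f D → L (c • f) = c * L f) (C : ℝ)
    (hbound : ∀ f, DifferentiableOn ℂ f D → ∀ g : Lp ℂ 2 (volume.restrict D),
      g =ᵐ[volume.restrict D] f → ‖L f‖ ≤ C * ‖g‖) :
    ∃ φ, MemBergmanSpace D φ ∧
      ∀ f, MemBergmanSpace D f → L f = ∫ z in D, f z * conj (φ z) := by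
  have : CompleteSpace (bergmanSubmodule D) := (isClosed_bergmanSubmodule hD).completeSpace_coe
  -- L acts on functions, not on classes. It descends because holomorphic functions that agree
  -- almost everywhere on the open set `D` agree on `D`.
  choose rep hrep1 hrep2 using fun g : bergmanSubmodule D => g.2
  have hL : ∀ (g : bergmanSubmodule D) f, DifferentiableOn ℂ f D →
      (g : Lp ℂ 2 (volume.restrict D)) =ᵐ[volume.restrict D] f → L (rep g) = L f :=
    fun g f hf h => hcongr _ _ (eqOn_of_ae_eq hD (hrep1 g) hf ((hrep2 g).symm.trans h))
  let Λ : bergmanSubmodule D →ₗ[ℂ] ℂ :=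
    { toFun := fun g => L (rep g)
      map_add' := fun a b => by
        rw [← hadd _ _ (hrep1 a) (hrep1 b)]
        exact hL _ _ ((hrep1 a).add (hrep1 b))
          ((Lp.coeFn_add _ _).trans ((hrep2 a).add (hrep2 b)))
      map_smul' := fun c a => by
        rw [RingHom.id_apply, smul_eq_mul, ← hsmul _ _ (hrep1 a)]
        exact hL _ _ ((hrep1 a).const_smul c)
          ((Lp.coeFn_smul _ _).trans ((hrep2 a).const_smul c)) }
  let Λ' : StrongDual ℂ (bergmanSubmodule D) :=
    Λ.mkContinuous C fun g => hbound _ (hrep1 g) _ (hrep2 g)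
  let k := (InnerProductSpace.toDual ℂ (bergmanSubmodule D)).symm Λ'
  refine ⟨rep k, ⟨hrep1 k, (memLp_congr_ae (hrep2 k)).1 (Lp.memLp _)⟩, fun f hf => ?_⟩
  have h1 : inner ℂ k ⟨_, hf.toLp_mem⟩ = Λ' ⟨_, hf.toLp_mem⟩ :=
    InnerProductSpace.toDual_symm_apply
  have h2 : Λ' ⟨_, hf.toLp_mem⟩ = L f := hL ⟨_, hf.toLp_mem⟩ f hf.1 hf.2.coeFn_toLp
  rw [← h2, ← h1, Submodule.coe_inner, L2.inner_def]
  refine integral_congr_ae ?_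
  filter_upwards [hrep2 k, hf.2.coeFn_toLp] with z hz1 hz2
  rw [RCLike.inner_apply, hz1, hz2]

/-- Riesz representation of point evaluations shows that the default value 0 in the definition is
not used. -/
theorem isBergmanKernel_bergmanKernel (hD : IsOpen D) : IsBergmanKernel D (bergmanKernel D) := by
  have hex : ∃ K, IsBergmanKernel D K := by
    have h : ∀ w ∈ D, ∃ φ, MemBergmanSpace D φ ∧
        ∀ f, MemBergmanSpace D f → f w = ∫ z in D, f z * conj (φ z) := by
      intro w hw
      obtain ⟨r, hr, hrD⟩ := exists_ball_subset hD hw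
      obtain ⟨C, -, hC⟩ := exists_norm_le_of_ball_subset D hr hrD
      exact exists_representing hD (fun f => f w) (fun f g h => h hw) (fun f g _ _ => rfl)
        (fun c f _ => rfl) C fun f hf g hg => hC f hf g hg w (mem_ball_self hr)
    choose! φ h1 h2 using h
    exact ⟨fun z w => φ w z, h1, fun f hf w hw => h2 w hw f hf⟩
  rw [bergmanKernel, dif_pos hex]
  exact hex.choose_spec

/-- Boundedness of the functional combines the local bound on point evaluations with the Cauchy
estimate. -/
theorem exists_representing_fderiv (hD : IsOpen D) {x : Fin n → ℂ} (hx : x ∈ D)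
    (v : Fin n → ℂ) :
    ∃ φ, MemBergmanSpace D φ ∧
      ∀ f, MemBergmanSpace D f → fderiv ℂ f x v = ∫ z in D, f z * conj (φ z) := by
  obtain ⟨r, hr, hrD⟩ := exists_ball_subset hD hx
  obtain ⟨C, hC0, hC⟩ := exists_norm_le_of_ball_subset D hr hrD
  have hsub : ball x r ⊆ D := (ball_subset_ball (by linarith)).trans hrD
  have hdiff : ∀ f : (Fin n → ℂ) → ℂ, DifferentiableOn ℂ f D → DifferentiableAt ℂ f x :=
    fun f hf => hf.differentiableAt (hD.mem_nhds hx)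
  refine exists_representing hD (fun f => fderiv ℂ f x v) (fun f g h => ?_) (fun f g hf hg => ?_)
    (fun c f hf => ?_) (2 * C / r * ‖v‖) fun f hf g hg => ?_
  · have e : fderiv ℂ f x = fderiv ℂ g x :=
      (Filter.eventuallyEq_of_mem (hD.mem_nhds hx) h).fderiv_eq
    exact congrArg (fun T => T v) e
  · rw [fderiv_add (hdiff f hf) (hdiff g hg)]; rfl
  · rw [fderiv_const_smul (hdiff f hf)]; rfl
  · refine ((fderiv ℂ f x).le_opNorm v).trans ?_
    have := norm_fderiv_le_of_norm_le hr (hf.mono hsub) (hC f hf g hg)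
    calc ‖fderiv ℂ f x‖ * ‖v‖ ≤ 2 * (C * ‖g‖) / r * ‖v‖ := by gcongr
      _ = 2 * C / r * ‖v‖ * ‖g‖ := by ring

end BergmanSpace

end QuasiReinhardt

namespace QuasiReinhardt

open Metric Set Filter Topology

/-! ### The L² pairing and uniqueness of representing functions. -/

section Pairing

variable {n : ℕ} {D : Set (Fin n → ℂ)}

theorem MemBergmanSpace.integrable_mul_conj {f g : (Fin n → ℂ) → ℂ} (hf : MemBergmanSpace D f)
    (hg : MemBergmanSpace D g) : IntegrableOn (fun z => f z * conj (g z)) D :=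
  MemLp.integrable_mul (p := 2) (q := 2) hf.2 hg.2.star

theorem integral_mul_conj_swap (f g : (Fin n → ℂ) → ℂ) :
    ∫ z in D, f z * conj (g z) = conj (∫ z in D, g z * conj (f z)) := by
  rw [← integral_conj]
  simp [mul_comm]

theorem MemBergmanSpace.integral_mul_conj_self {f : (Fin n → ℂ) → ℂ} (hf : MemBergmanSpace D f) :
    ∫ z in D, f z * conj (f z) = ((‖hf.2.toLp f‖ ^ 2 : ℝ) : ℂ) := by
  have h := inner_self_eq_norm_sq_to_K (𝕜 := ℂ) (hf.2.toLp f)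
  rw [L2.inner_def] at h
  push_cast
  refine Eq.trans (integral_congr_ae ?_) h
  filter_upwards [hf.2.coeFn_toLp] with z hz
  rw [RCLike.inner_apply, hz]

theorem MemBergmanSpace.eqOn_zero (hD : IsOpen D) {f : (Fin n → ℂ) → ℂ}
    (hf : MemBergmanSpace D f) (h : ∫ z in D, f z * conj (f z) = 0) : EqOn f 0 D := by
  rw [hf.integral_mul_conj_self, Complex.ofReal_eq_zero, sq_eq_zero_iff, norm_eq_zero] at h
  refine eqOn_of_ae_eq hD hf.1 (differentiableOn_const 0) ?_
  refine hf.2.coeFn_toLp.symm.trans ?_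
  rw [h]
  exact Lp.coeFn_zero _ _ _

/-- Representing functions in the Bergman space are unique on `D`. -/
theorem eqOn_of_forall_integral_eq (hD : IsOpen D) {φ ψ : (Fin n → ℂ) → ℂ}
    (hφ : MemBergmanSpace D φ) (hψ : MemBergmanSpace D ψ)
    (h : ∀ f, MemBergmanSpace D f →
      ∫ z in D, f z * conj (φ z) = ∫ z in D, f z * conj (ψ z)) : EqOn φ ψ D := by
  have hd := hφ.sub hψ
  have h0 : ∫ z in D, (φ - ψ) z * conj ((φ - ψ) z) = 0 := by
    simp_rw [Pi.sub_apply φ ψ, map_sub, mul_sub]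
    have := integral_sub (hd.integrable_mul_conj hφ) (hd.integrable_mul_conj hψ)
    rw [h _ hd, sub_self] at this
    exact this
  exact fun z hz => sub_eq_zero.1 (hd.eqOn_zero hD h0 hz)

end Pairing

/-! ### Unitarity of the torus action on the Bergman space. -/

section Equivariance

variable {n r : ℕ} {m : Fin n → Fin r → ℤ} {D : Set (Fin n → ℂ)}

theorem torusAction_inv' (m : Fin n → Fin r → ℤ) (lam : Fin r → Circle) (z : Fin n → ℂ) :
    torusAction m lam (torusAction m lam⁻¹ z) = z := by
  simpa using torusAction_inv m lam⁻¹ z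

theorem preimage_torusAction (hinv : ∀ (lam : Fin r → Circle), ∀ z ∈ D, torusAction m lam z ∈ D)
    (lam : Fin r → Circle) : torusAction m lam ⁻¹' D = D := by
  ext z
  refine ⟨fun h => ?_, hinv lam z⟩
  simpa [torusAction_inv] using hinv lam⁻¹ _ h

theorem measurePreserving_torusAction (m : Fin n → Fin r → ℤ) (lam : Fin r → Circle) :
    MeasurePreserving (torusAction m lam) :=
  measurePreserving_diagonal fun _ => norm_character _ _

theorem measurePreserving_restrict_torusAction (hD : IsOpen D)
    (hinv : ∀ (lam : Fin r → Circle), ∀ z ∈ D, torusAction m lam z ∈ D) (lam : Fin r → Circle) :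
    MeasurePreserving (torusAction m lam) (volume.restrict D) (volume.restrict D) := by
  have := (measurePreserving_torusAction m lam).restrict_preimage hD.measurableSet
  rwa [preimage_torusAction hinv] at this

theorem measurableEmbedding_torusAction (m : Fin n → Fin r → ℤ) (lam : Fin r → Circle) :
    MeasurableEmbedding (torusAction m lam) :=
  (Homeomorph.mk ⟨torusAction m lam, torusAction m lam⁻¹, torusAction_inv m lam,
    torusAction_inv' m lam⟩ (torusCLM m lam).continuous
    (torusCLM m lam⁻¹).continuous).measurableEmbedding

theorem setIntegral_comp_torusAction (hD : IsOpen D)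
    (hinv : ∀ (lam : Fin r → Circle), ∀ z ∈ D, torusAction m lam z ∈ D) (lam : Fin r → Circle)
    (f : (Fin n → ℂ) → ℂ) : ∫ z in D, f (torusAction m lam z) = ∫ z in D, f z :=
  (measurePreserving_restrict_torusAction hD hinv lam).integral_comp
    (measurableEmbedding_torusAction m lam) f

theorem MemBergmanSpace.comp_torusAction (hD : IsOpen D)
    (hinv : ∀ (lam : Fin r → Circle), ∀ z ∈ D, torusAction m lam z ∈ D)
    {f : (Fin n → ℂ) → ℂ} (hf : MemBergmanSpace D f) (lam : Fin r → Circle) :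
    MemBergmanSpace D (f ∘ torusAction m lam) :=
  ⟨hf.1.comp (torusCLM m lam).differentiable.differentiableOn (hinv lam),
    hf.2.comp_measurePreserving (measurePreserving_restrict_torusAction hD hinv lam)⟩

theorem conj_character (μ : Fin r → ℤ) (lam : Fin r → Circle) :
    conj (character μ lam) = (character μ lam)⁻¹ :=
  (Complex.inv_eq_conj (norm_character μ lam)).symm

/-- The function representing an equivariant functional on the Bergman space is semi-invariant. -/
theorem isSemiInvariant_of_representing (hD : IsOpen D)
    (hinv : ∀ (lam : Fin r → Circle), ∀ z ∈ D, torusAction m lam z ∈ D) {μ : Fin r → ℤ}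
    {L : ((Fin n → ℂ) → ℂ) → ℂ} {φ : (Fin n → ℂ) → ℂ} (hφ : MemBergmanSpace D φ)
    (hL : ∀ f, MemBergmanSpace D f → L f = ∫ z in D, f z * conj (φ z))
    (heq : ∀ f, MemBergmanSpace D f → ∀ lam, L (f ∘ torusAction m lam) = character μ lam * L f) :
    IsSemiInvariant m D μ φ := by
  intro lam
  refine eqOn_of_forall_integral_eq hD (φ := φ ∘ torusAction m lam)
    (ψ := character μ lam • φ) (hφ.comp_torusAction hD hinv lam) (hφ.const_smul _) fun f hf => ?_
  -- A change of variables moves the action from φ to f, with λ inverted. Equivariance of L then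
  -- yields λ^{-μ}, the conjugate of λ^μ.
  have hf' := hf.comp_torusAction hD hinv lam⁻¹
  have h1 := setIntegral_comp_torusAction hD hinv lam
    fun z => (f ∘ torusAction m lam⁻¹) z * conj (φ z)
  simp only [Function.comp_apply, torusAction_inv] at h1
  have h2 := hL _ hf'
  rw [heq f hf, character_inv] at h2
  simp only [Function.comp_apply] at h2 ⊢
  rw [h1, ← h2, hL f hf, ← integral_const_mul]
  refine integral_congr_ae (Eventually.of_forall fun z => ?_)
  simp only [Pi.smul_apply, smul_eq_mul, map_mul, conj_character]
  ring

end Equivariance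

/-! ### Wirtinger derivatives of holomorphic and antiholomorphic functions. -/

section Wirtinger

variable {n : ℕ}

theorem single_I (k : Fin n) :
    (Pi.single k Complex.I : Fin n → ℂ) = Complex.I • Pi.single k 1 := by
  rw [← Pi.single_smul, smul_eq_mul, mul_one]

theorem wirtinger_eq_fderiv {f : (Fin n → ℂ) → ℂ} {z : Fin n → ℂ} (hf : DifferentiableAt ℂ f z)
    (k : Fin n) : wirtinger k f z = fderiv ℂ f z (Pi.single k 1) := by
  rw [wirtinger, hf.fderiv_restrictScalars ℝ, single_I]
  simp only [ContinuousLinearMap.coe_restrictScalars', map_smul, smul_eq_mul]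
  rw [← mul_assoc, Complex.I_mul_I]
  ring

theorem hasFDerivAt_conj {f : (Fin n → ℂ) → ℂ} {z : Fin n → ℂ} (hf : DifferentiableAt ℂ f z) :
    HasFDerivAt (fun w => conj (f w))
      ((Complex.conjCLE : ℂ →L[ℝ] ℂ).comp ((fderiv ℂ f z).restrictScalars ℝ)) z :=
  (Complex.conjCLE : ℂ →L[ℝ] ℂ).hasFDerivAt.comp z (hf.hasFDerivAt.restrictScalars ℝ)

/-- The differential is conjugate-linear, so ∂/∂w̄_k is its value on e_k. Only the differential at
one point matters, so F need not be antiholomorphic. -/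
theorem wirtingerBar_eq_of_hasFDerivAt {F f : (Fin n → ℂ) → ℂ} {z : Fin n → ℂ} {a : ℂ}
    (hF : HasFDerivAt F (a • (Complex.conjCLE : ℂ →L[ℝ] ℂ).comp
      ((fderiv ℂ f z).restrictScalars ℝ)) z) (k : Fin n) :
    wirtingerBar k F z = a * conj (fderiv ℂ f z (Pi.single k 1)) := by
  rw [wirtingerBar, hF.fderiv, single_I]
  simp only [smul_apply, ContinuousLinearMap.comp_apply,
    ContinuousLinearMap.coe_restrictScalars', map_smul, smul_eq_mul]
  simp only [ContinuousLinearEquiv.coe_coe, Complex.conjCLE_apply, map_mul, Complex.conj_I]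
  linear_combination (-(1 / 2) * a * conj (fderiv ℂ f z (Pi.single k 1))) * Complex.I_mul_I

theorem wirtingerBar_congr {F G : (Fin n → ℂ) → ℂ} {z : Fin n → ℂ} (h : F =ᶠ[𝓝 z] G)
    (k : Fin n) : wirtingerBar k F z = wirtingerBar k G z := by
  rw [wirtingerBar, wirtingerBar, h.fderiv_eq]

end Wirtinger

/-! ### The Bergman kernel near the origin. -/

section Kernel

variable {n r : ℕ} {m : Fin n → Fin r → ℤ} {D : Set (Fin n → ℂ)}

theorem IsBergmanKernel.conj_symm {K : (Fin n → ℂ) → (Fin n → ℂ) → ℂ} (hK : IsBergmanKernel D K)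
    {z w : Fin n → ℂ} (hz : z ∈ D) (hw : w ∈ D) : K z w = conj (K w z) := by
  rw [hK.2 _ (hK.1 w hw) z hz, hK.2 _ (hK.1 z hz) w hw]
  exact integral_mul_conj_swap (D := D) (fun x => K x w) fun x => K x z

/-- Boundedness of `D` enters the argument only here; it supplies 1 and the coordinate functions as
test functions. -/
theorem memBergmanSpace_of_bounded (hD : IsOpen D) (hb : Bornology.IsBounded D)
    {f : (Fin n → ℂ) → ℂ} (hf : Differentiable ℂ f) : MemBergmanSpace D f := by
  refine ⟨hf.differentiableOn, ?_⟩
  have hfin : IsFiniteMeasure (volume.restrict D) := ⟨by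
    rw [Measure.restrict_apply_univ]; exact hb.measure_lt_top⟩
  obtain ⟨C, hC⟩ := hb.isCompact_closure.exists_bound_of_continuousOn hf.continuous.continuousOn
  refine MemLp.of_bound hf.continuous.aestronglyMeasurable C ?_
  filter_upwards [ae_restrict_mem hD.measurableSet] with z hz using hC z (subset_closure hz)

/-- The Bergman kernel of a bounded quasi-Reinhardt domain is constant in `z` at `w = 0`. -/
theorem exists_bergmanKernel_zero_eq (hD : IsBoundedQuasiReinhardt D m) :
    ∃ c : ℂ, c ≠ 0 ∧ conj c = c ∧ (∀ z ∈ D, bergmanKernel D z 0 = c) ∧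
      ∀ w ∈ D, bergmanKernel D 0 w = c := by
  have hK := isBergmanKernel_bergmanKernel hD.isOpen
  have h0 := hD.zero_mem
  have hs : IsSemiInvariant m D 0 fun z => bergmanKernel D z 0 :=
    isSemiInvariant_of_representing hD.isOpen hD.invariant (L := fun f => f 0) (hK.1 0 h0)
      (fun f hf => hK.2 f hf 0 h0) fun f _ lam => by
        simp [torusAction_zero, character_zero]
  obtain ⟨P, hP, hKP⟩ := exists_eval_eq hD.isOpen hD.isConnected.isPreconnected h0 hD.invariant
    hD.onlyConstantInvariants (hK.1 0 h0).1 hs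
  have hPC : P = MvPolynomial.C (MvPolynomial.coeff 0 P) := by
    classical
    ext α
    rw [MvPolynomial.coeff_C]
    split_ifs with h
    · rw [h]
    · by_contra hne
      exact h (eq_zero_of_weight_eq_zero hD.onlyConstantInvariants (hP hne)).symm
  set c := MvPolynomial.coeff 0 P
  have hc : ∀ z ∈ D, bergmanKernel D z 0 = c := fun z hz => by
    rw [hKP z hz, hPC, MvPolynomial.eval_C]
  have hcc : conj c = c := by
    have := hK.conj_symm h0 h0
    rw [hc 0 h0] at this
    exact this.symm
  refine ⟨c, fun hc0 => ?_, hcc, hc, fun w hw => ?_⟩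
  -- If c were 0, reproducing the constant function 1 at the origin would give 1 = 0.
  · have h1 := hK.2 (fun _ => 1) (memBergmanSpace_of_bounded hD.isOpen hD.isBounded
      (differentiable_const 1)) 0 h0
    rw [setIntegral_congr_fun hD.isOpen.measurableSet (g := fun _ => 0) fun z hz => by
      simp [hc z hz, hc0]] at h1
    simp at h1
  · rw [hK.conj_symm h0 hw, hc w hw, hcc]

/-- Put f = K(·,w) - K(·,0). As K(·,0) and K(0,·) are the same constant, K(w,w) - K(0,0) = f(w) -
f(0) = ‖f‖². Bounded point evaluations and the Schwarz lemma bound this by a constant times ‖f‖·‖w‖,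
so ‖f‖ is O(‖w‖) and the difference is O(‖w‖²). No joint smoothness of the kernel is needed. -/
theorem hasFDerivAt_bergmanKernel_diag (hD : IsBoundedQuasiReinhardt D m) :
    HasFDerivAt (fun w => bergmanKernel D w w) (0 : (Fin n → ℂ) →L[ℝ] ℂ) 0 := by
  have hK := isBergmanKernel_bergmanKernel hD.isOpen
  have h0 := hD.zero_mem
  obtain ⟨c, -, -, hc1, hc2⟩ := exists_bergmanKernel_zero_eq hD
  obtain ⟨R, hR, hRD⟩ := exists_ball_subset hD.isOpen h0
  obtain ⟨C, hC0, hC⟩ := exists_norm_le_of_ball_subset D hR hRD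
  have hsub : ball (0 : Fin n → ℂ) R ⊆ D := (ball_subset_ball (by linarith)).trans hRD
  have key : ∀ w ∈ ball (0 : Fin n → ℂ) R,
      ‖bergmanKernel D w w - bergmanKernel D 0 0‖ ≤ (2 * C / R) ^ 2 * ‖w‖ ^ 2 := by
    intro w hw
    have hwD := hsub hw
    have hf := (hK.1 w hwD).sub (hK.1 0 h0)
    set f : (Fin n → ℂ) → ℂ := (fun z => bergmanKernel D z w) - fun z => bergmanKernel D z 0
    set N := ‖hf.2.toLp f‖
    have hfw : f w - f 0 = bergmanKernel D w w - bergmanKernel D 0 0 := by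
      simp only [f, Pi.sub_apply, hc1 w hwD, hc1 0 h0, hc2 w hwD]
      ring
    have hN : f w - f 0 = ((N ^ 2 : ℝ) : ℂ) := by
      rw [← hf.integral_mul_conj_self, hK.2 f hf w hwD, hK.2 f hf 0 h0, ← integral_sub
        (hf.integrable_mul_conj (hK.1 w hwD)) (hf.integrable_mul_conj (hK.1 0 h0))]
      refine integral_congr_ae (Eventually.of_forall fun z => ?_)
      simp only [f, Pi.sub_apply, map_sub]
      ring
    have hlip : ‖f w - f 0‖ ≤ 2 * (C * N) / R * ‖w‖ := by
      have hb := hC f hf.1 _ hf.2.coeFn_toLp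
      have := Complex.dist_le_div_mul_dist_of_mapsTo_ball (hf.1.mono hsub) (R₂ := 2 * (C * N))
        (fun z hz => ?_) hw
      · simpa [dist_eq_norm] using this
      · rw [mem_closedBall, dist_eq_norm]
        linarith [norm_sub_le (f z) (f 0), hb z hz, hb 0 (mem_ball_self hR)]
    have hN0 : 0 ≤ N := norm_nonneg _
    rw [hN, Complex.norm_real, Real.norm_of_nonneg (sq_nonneg N)] at hlip
    rw [← hfw, hN, Complex.norm_real, Real.norm_of_nonneg (sq_nonneg N), ← mul_pow]
    have hle : N ≤ 2 * C / R * ‖w‖ := by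
      rcases hN0.eq_or_lt with h | h
      · rw [← h]; positivity
      · refine le_of_mul_le_mul_left ?_ h
        calc N * N = N ^ 2 := by ring
          _ ≤ _ := hlip
          _ = N * (2 * C / R * ‖w‖) := by ring
    exact pow_le_pow_left₀ hN0 hle 2
  refine HasFDerivAt.of_isLittleO ?_
  have hO : (fun w => bergmanKernel D w w - bergmanKernel D 0 0) =O[𝓝 (0 : Fin n → ℂ)]
      fun w => ‖w‖ ^ 2 := by
    refine Asymptotics.IsBigO.of_bound ((2 * C / R) ^ 2) ?_
    filter_upwards [ball_mem_nhds (0 : Fin n → ℂ) hR] with w hw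
    rw [Real.norm_of_nonneg (sq_nonneg ‖w‖)]
    exact key w hw
  simpa using hO.trans_isLittleO (Asymptotics.isLittleO_norm_pow_id one_lt_two)

end Kernel

end QuasiReinhardt

namespace QuasiReinhardt

open MvPolynomial

/-! ### Resonant polynomial maps are triangular and invertible. -/

section Triangular

variable {n r : ℕ} {m : Fin n → Fin r → ℤ}

/-- The grading and the ideal power are both compatible with products, which makes substitution
tractable. -/
theorem onlyNonlinearResonant_iff {i : Fin n} {g : MvPolynomial (Fin n) ℂ} :
    OnlyNonlinearResonant m i g ↔
      IsWeightedHomogeneous m g (m i) ∧ g ∈ idealOfVars (Fin n) ℂ ^ 2 := by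
  rw [mem_pow_idealOfVars_iff]
  refine ⟨fun h => ⟨fun α hα => ?_, fun α hα => ?_⟩, fun h α hα => ⟨?_, ?_⟩⟩
  · exact (mem_resonanceSet_iff m i α).1 (h α (mem_support_iff.2 hα)).2
  · rw [Finsupp.degree_eq_sum]
    exact (h α hα).1
  · rw [← Finsupp.degree_eq_sum]
    exact h.2 α hα
  · exact (mem_resonanceSet_iff m i α).2 (h.1 (mem_support_iff.1 hα))

theorem weight_single (m : Fin n → Fin r → ℤ) (k : Fin n) :
    Finsupp.weight m (Finsupp.single k 1) = m k := by
  rw [Finsupp.weight_single, one_smul]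

/-- There is no constant term because m_i ≠ 0, as z_i would otherwise be an invariant monomial; the
linear terms cancel by `hlin`. -/
theorem onlyNonlinearResonant_sub_X (hm : OnlyConstantInvariants m) {i : Fin n}
    {P : MvPolynomial (Fin n) ℂ} (hP : IsWeightedHomogeneous m P (m i))
    (hlin : ∀ k, coeff (Finsupp.single k 1) P = if k = i then 1 else 0) :
    OnlyNonlinearResonant m i (P - X i) := by
  classical
  have hw : IsWeightedHomogeneous m (P - X i) (m i) := hP.sub (isWeightedHomogeneous_X ℂ m i)
  intro α hα
  have hα' := hw (mem_support_iff.1 hα)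
  refine ⟨?_, (mem_resonanceSet_iff m i α).2 hα'⟩
  rw [← Finsupp.degree_eq_sum]
  by_contra hlt
  have h01 : α.degree = 0 ∨ α.degree = 1 := by omega
  rcases h01 with h | h
  · rw [Finsupp.degree_eq_zero_iff] at h
    rw [h, map_zero] at hα'
    have := eq_zero_of_weight_eq_zero hm ((weight_single m i).trans hα'.symm)
    simp at this
  · obtain ⟨k, rfl⟩ := (Finsupp.sum_eq_one_iff α).1 h
    refine mem_support_iff.1 hα ?_
    rw [coeff_sub, hlin, coeff_X, sub_eq_zero]
    simp [Finsupp.single_left_inj, eq_comm]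

/-- If m_l = m_i, the cofactor of z_l in z^α has weight zero, hence is 1, contradicting |α| ≥ 2.
Otherwise proper ordering applies. -/
theorem OnlyNonlinearResonant.lt (hm : OnlyConstantInvariants m) (ho : ProperlyOrdered m)
    {i : Fin n} {g : MvPolynomial (Fin n) ℂ} (hg : OnlyNonlinearResonant m i g)
    {α : Fin n →₀ ℕ} (hα : α ∈ g.support) {l : Fin n} (hl : α l ≠ 0) : l < i := by
  obtain ⟨h2, hres⟩ := hg α hα
  refine ho l i (fun heq => ?_) ⟨α, hres, hl⟩
  have hle : Finsupp.single l 1 ≤ α := by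
    rw [Finsupp.single_le_iff]; omega
  obtain ⟨β, rfl⟩ := exists_add_of_le hle
  rw [mem_resonanceSet_iff, map_add, weight_single, heq, add_eq_left] at hres
  rw [eq_zero_of_weight_eq_zero hm hres, add_zero, ← Finsupp.degree_eq_sum,
    Finsupp.degree_single] at h2
  omega

theorem aeval_congr_support {A : Type*} [CommRing A] [Algebra ℂ A] {g : MvPolynomial (Fin n) ℂ}
    {a b : Fin n → A} (h : ∀ α ∈ g.support, ∀ l, α l ≠ 0 → a l = b l) :
    aeval a g = aeval b g := by
  rw [aeval_def, aeval_def, eval₂_eq', eval₂_eq']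
  refine Finset.sum_congr rfl fun α hα => ?_
  congr 1
  refine Finset.prod_congr rfl fun l _ => ?_
  by_cases hl : α l = 0
  · rw [hl, pow_zero, pow_zero]
  · rw [h α hα l hl]

/-- Substituting resonant perturbations of the identity preserves nonlinear resonance. -/
theorem OnlyNonlinearResonant.aeval_add {i : Fin n} {g : MvPolynomial (Fin n) ℂ}
    (hg : OnlyNonlinearResonant m i g) {h : Fin n → MvPolynomial (Fin n) ℂ}
    (hh : ∀ l, OnlyNonlinearResonant m l (h l)) :
    OnlyNonlinearResonant m i (aeval (fun l => X l + h l) g) := by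
  have hq1 : ∀ l, IsWeightedHomogeneous m (X l + h l) (m l) := fun l =>
    (isWeightedHomogeneous_X ℂ m l).add (onlyNonlinearResonant_iff.1 (hh l)).1
  have hq2 : ∀ l, X l + h l ∈ idealOfVars (Fin n) ℂ := fun l =>
    add_mem (Ideal.subset_span ⟨l, rfl⟩)
      (Ideal.pow_le_self two_ne_zero (onlyNonlinearResonant_iff.1 (hh l)).2)
  rw [onlyNonlinearResonant_iff, aeval_def, eval₂_eq']
  refine ⟨IsWeightedHomogeneous.sum _ _ _ fun α hα => ?_, Ideal.sum_mem _ fun α hα => ?_⟩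
  · refine IsWeightedHomogeneous.C_mul ?_ _
    have hw := (mem_resonanceSet_iff m i α).1 (hg α hα).2
    rw [weight_eq] at hw
    rw [← hw]
    exact IsWeightedHomogeneous.prod _ _ _ fun l _ => (hq1 l).pow (α l)
  · refine Ideal.mul_mem_left _ _ ?_
    have h1 : ∏ l, (X l + h l) ^ α l ∈ ∏ l, idealOfVars (Fin n) ℂ ^ α l :=
      Ideal.prod_mem_prod fun l _ => Ideal.pow_mem_pow (hq2 l) _
    rw [Finset.prod_pow_eq_pow_sum] at h1
    exact Ideal.pow_le_pow_right (hg α hα).1 h1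

theorem OnlyNonlinearResonant.neg {i : Fin n} {g : MvPolynomial (Fin n) ℂ}
    (hg : OnlyNonlinearResonant m i g) : OnlyNonlinearResonant m i (-g) := by
  intro α hα
  rw [support_neg] at hα
  exact hg α hα

/-- The equation says that X + h is a right inverse of X + g under composition. Its i-th component
involves only h_l with l < i, so it can be solved one index at a time. -/
theorem exists_formal_inverse (hm : OnlyConstantInvariants m) (ho : ProperlyOrdered m)
    {g : Fin n → MvPolynomial (Fin n) ℂ} (hg : ∀ i, OnlyNonlinearResonant m i (g i)) :
    ∃ h : Fin n → MvPolynomial (Fin n) ℂ, (∀ i, OnlyNonlinearResonant m i (h i)) ∧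
      ∀ i, h i = -aeval (fun l => X l + h l) (g i) := by
  suffices H : ∀ k : ℕ, ∃ h : Fin n → MvPolynomial (Fin n) ℂ,
      (∀ i, OnlyNonlinearResonant m i (h i)) ∧
      ∀ i : Fin n, (i : ℕ) < k → h i = -aeval (fun l => X l + h l) (g i) by
    obtain ⟨h, h1, h2⟩ := H n
    exact ⟨h, h1, fun i => h2 i i.2⟩
  intro k
  induction k with
  | zero => exact ⟨0, fun i α hα => by simp at hα, fun i hi => by omega⟩
  | succ k ih =>
    obtain ⟨h, h1, h2⟩ := ih
    refine ⟨fun i => if (i : ℕ) < k then h i else -aeval (fun l => X l + h l) (g i), fun i => ?_,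
      fun i hi => ?_⟩
    · dsimp only
      split_ifs
      · exact h1 i
      · exact ((hg i).aeval_add h1).neg
    · have hcongr : aeval (fun l : Fin n => X l +
          if (l : ℕ) < k then h l else -aeval (fun l => X l + h l) (g l)) (g i) =
          aeval (fun l => X l + h l) (g i) := by
        refine aeval_congr_support fun α hα l hl => ?_
        have hli : (l : ℕ) < i := (hg i).lt hm ho hα hl
        rw [if_pos (by omega)]
      rw [hcongr]
      dsimp only
      split_ifs with hik
      · exact h2 i hik
      · rfl

/-- A triangular polynomial map of resonant form has an inverse of the same form. -/
theorem exists_inverse (hm : OnlyConstantInvariants m) (ho : ProperlyOrdered m)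
    {g : Fin n → MvPolynomial (Fin n) ℂ} (hg : ∀ i, OnlyNonlinearResonant m i (g i)) :
    ∃ h : Fin n → MvPolynomial (Fin n) ℂ, (∀ i, OnlyNonlinearResonant m i (h i)) ∧
      ∀ z w : Fin n → ℂ, (∀ i, w i = z i + eval z (g i)) → ∀ i, z i = w i + eval w (h i) := by
  obtain ⟨h, h1, h2⟩ := exists_formal_inverse hm ho hg
  refine ⟨h, h1, fun z w hw i => ?_⟩
  induction i using WellFoundedLT.induction with
  | ind i ih =>
  -- By induction z_l = w_l + h_l(w) for every variable z_l occurring in g_i.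
  have e : eval w (h i) = -eval z (g i) := by
    rw [h2 i, map_neg, neg_inj, ← coe_aeval_eq_eval w, ← coe_aeval_eq_eval z]
    simp only [RingHom.coe_coe]
    rw [← AlgHom.comp_apply, comp_aeval]
    refine aeval_congr_support fun α hα l hl => ?_
    rw [ih l ((hg i).lt hm ho hα hl), map_add, aeval_X, ← coe_aeval_eq_eval w, RingHom.coe_coe]
  rw [e, hw i]
  ring

end Triangular

end QuasiReinhardt

namespace QuasiReinhardt

open Metric Set Filter Topology

/-! ### Representative coordinates through the functions representing partial derivatives. -/

section RepresentativeCoordinates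

variable {n r : ℕ} {m : Fin n → Fin r → ℤ} {D : Set (Fin n → ℂ)}

/-- `φ k` represents the `k`-th partial derivative at the origin on the Bergman space. -/
def RepresentsPartials (D : Set (Fin n → ℂ)) (φ : Fin n → (Fin n → ℂ) → ℂ) : Prop :=
  ∀ k, MemBergmanSpace D (φ k) ∧ ∀ f, MemBergmanSpace D f →
    fderiv ℂ f 0 (Pi.single k 1) = ∫ z in D, f z * conj (φ k z)

variable {φ : Fin n → (Fin n → ℂ) → ℂ}

theorem RepresentsPartials.isSemiInvariant (hD : IsBoundedQuasiReinhardt D m)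
    (hφ : RepresentsPartials D φ) (k : Fin n) : IsSemiInvariant m D (m k) (φ k) := by
  refine isSemiInvariant_of_representing hD.isOpen hD.invariant
    (L := fun f => fderiv ℂ f 0 (Pi.single k 1)) (hφ k).1 (hφ k).2 fun f hf lam => ?_
  have h1 : HasFDerivAt (f ∘ torusCLM m lam)
      ((fderiv ℂ f (torusCLM m lam 0)).comp (torusCLM m lam)) 0 := by
    refine HasFDerivAt.comp 0 (hf.1.differentiableAt ?_).hasFDerivAt (torusCLM m lam).hasFDerivAt
    rw [map_zero]
    exact hD.isOpen.mem_nhds hD.zero_mem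
  have h2 : f ∘ torusAction m lam = f ∘ torusCLM m lam := rfl
  rw [h2, h1.fderiv, map_zero, ContinuousLinearMap.comp_apply, torusCLM_single, map_smul,
    smul_eq_mul]

/-- The pairing of K(·,w) with φ_k is a derivative by the choice of φ_k, and a conjugated value by
the reproducing property. -/
theorem RepresentsPartials.fderiv_bergmanKernel (hD : IsOpen D)
    (hφ : RepresentsPartials D φ) (k : Fin n) {w : Fin n → ℂ} (hw : w ∈ D) :
    fderiv ℂ (fun z => bergmanKernel D z w) 0 (Pi.single k 1) = conj (φ k w) := by
  have hK := isBergmanKernel_bergmanKernel hD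
  rw [(hφ k).2 _ (hK.1 w hw), hK.2 _ (hφ k).1 w hw]
  exact integral_mul_conj_swap (D := D) (fun z => bergmanKernel D z w) (φ k)

theorem RepresentsPartials.conj_fderiv (hφ : RepresentsPartials D φ) (i k : Fin n) :
    conj (fderiv ℂ (φ k) 0 (Pi.single i 1)) = fderiv ℂ (φ i) 0 (Pi.single k 1) := by
  rw [(hφ i).2 _ (hφ k).1, (hφ k).2 _ (hφ i).1]
  exact (integral_mul_conj_swap (D := D) (φ i) (φ k)).symm

/-- As K(0,w) = c, the inner logarithmic derivative is c⁻¹ times the conjugate of φ_k(w). Hermitian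
symmetry of the Gram matrix then exchanges the indices. -/
theorem RepresentsPartials.bergmanTensor_apply (hD : IsBoundedQuasiReinhardt D m)
    (hφ : RepresentsPartials D φ) {c : ℂ} (hc : ∀ w ∈ D, bergmanKernel D 0 w = c) (i k : Fin n) :
    bergmanTensor D 0 0 i k = c⁻¹ * fderiv ℂ (φ i) 0 (Pi.single k 1) := by
  have hK := isBergmanKernel_bergmanKernel hD.isOpen
  have hnhds := hD.isOpen.mem_nhds hD.zero_mem
  have hev : (fun w => wirtingerLog k (fun z => bergmanKernel D z w) 0) =ᶠ[𝓝 0]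
      fun w => c⁻¹ * conj (φ k w) := by
    filter_upwards [hnhds] with w hw
    rw [wirtingerLog, wirtinger_eq_fderiv ((hK.1 w hw).1.differentiableAt hnhds),
      hφ.fderiv_bergmanKernel hD.isOpen k hw, hc w hw, div_eq_inv_mul]
  rw [bergmanTensor, Matrix.of_apply, wirtingerBar_congr hev, wirtingerBar_eq_of_hasFDerivAt
    ((hasFDerivAt_conj ((hφ k).1.1.differentiableAt hnhds)).const_mul c⁻¹), hφ.conj_fderiv]

/-- The denominator K(w,w) is stationary at 0, so only K(z,w), the conjugate of K(w,z), is
differentiated; the quotient itself is 1 at w = 0. -/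
theorem RepresentsPartials.wirtingerBarLog_eq (hD : IsBoundedQuasiReinhardt D m)
    (hφ : RepresentsPartials D φ) {c : ℂ} (hc0 : c ≠ 0) (hc : ∀ z ∈ D, bergmanKernel D z 0 = c)
    {z : Fin n → ℂ} (hz : z ∈ D) (i : Fin n) :
    wirtingerBarLog i (fun w => bergmanKernel D z w / bergmanKernel D w w) 0 = c⁻¹ * φ i z := by
  have hK := isBergmanKernel_bergmanKernel hD.isOpen
  have h0 := hD.zero_mem
  have hnhds := hD.isOpen.mem_nhds h0
  have hdz : DifferentiableAt ℂ (fun w => bergmanKernel D w z) 0 :=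
    (hK.1 z hz).1.differentiableAt hnhds
  have hev : (fun w => bergmanKernel D z w / bergmanKernel D w w) =ᶠ[𝓝 0]
      fun w => conj (bergmanKernel D w z) * (bergmanKernel D w w)⁻¹ := by
    filter_upwards [hnhds] with w hw
    rw [hK.conj_symm hz hw, div_eq_mul_inv]
  have hinv : HasFDerivAt (fun w => (bergmanKernel D w w)⁻¹) (0 : (Fin n → ℂ) →L[ℝ] ℂ) 0 := by
    have hne : bergmanKernel D (0 : Fin n → ℂ) 0 ≠ 0 := by rwa [hc 0 h0]
    have := HasFDerivAt.comp (f := fun w => bergmanKernel D w w) (0 : Fin n → ℂ)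
      (hasFDerivAt_inv' (𝕜 := ℝ) hne)
      (hasFDerivAt_bergmanKernel_diag hD)
    rwa [ContinuousLinearMap.comp_zero] at this
  have hprod : HasFDerivAt (fun w => conj (bergmanKernel D w z) * (bergmanKernel D w w)⁻¹)
      (c⁻¹ • (Complex.conjCLE : ℂ →L[ℝ] ℂ).comp
        ((fderiv ℂ (fun w => bergmanKernel D w z) 0).restrictScalars ℝ)) 0 := by
    refine ((hasFDerivAt_conj hdz).mul hinv).congr_fderiv ?_
    rw [hc 0 h0]
    ext v
    simp
  have hbar := wirtingerBar_eq_of_hasFDerivAt hprod i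
  rw [hφ.fderiv_bergmanKernel hD.isOpen i hz, Complex.conj_conj] at hbar
  rw [wirtingerBarLog, wirtingerBar_congr hev, hc z hz, hc 0 h0, div_self hc0, div_one]
  exact hbar

/-- If vT = 0, then f = ∑ v_i φ_i has zero differential at 0. Its pairing with itself is a
combination of these derivatives, so f = 0 on `D`. Pairing f with z_j then gives v_j = 0. -/
theorem RepresentsPartials.isUnit_det (hD : IsBoundedQuasiReinhardt D m)
    (hφ : RepresentsPartials D φ) {c : ℂ} (hc0 : c ≠ 0) (hc : ∀ w ∈ D, bergmanKernel D 0 w = c) :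
    IsUnit (bergmanTensor D 0 0).det := by
  rw [isUnit_iff_ne_zero]
  intro hdet
  obtain ⟨v, hv, hvT⟩ := Matrix.exists_vecMul_eq_zero_iff.2 hdet
  have hnhds := hD.isOpen.mem_nhds hD.zero_mem
  set f : (Fin n → ℂ) → ℂ := ∑ i, v i • φ i with hfdef
  have hf : MemBergmanSpace D f := MemBergmanSpace.sum _ fun i _ => (hφ i).1.const_smul _
  have hfz : ∀ z, f z = ∑ i, v i * φ i z := fun z => by simp [hfdef]
  have hpair : ∀ g, MemBergmanSpace D g → ∫ z in D, g z * conj (f z) =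
      ∑ i, conj (v i) * fderiv ℂ g 0 (Pi.single i 1) := by
    intro g hg
    simp_rw [hfz, map_sum, Finset.mul_sum]
    rw [integral_finsetSum]
    · refine Finset.sum_congr rfl fun i _ => ?_
      rw [(hφ i).2 g hg, ← integral_const_mul]
      refine integral_congr_ae (Eventually.of_forall fun z => ?_)
      simp only [map_mul]
      ring
    · intro i _
      exact hg.integrable_mul_conj ((hφ i).1.const_smul (v i))
  have hderiv : ∀ k, fderiv ℂ f 0 (Pi.single k 1) = 0 := by
    intro k
    have h1 := congrFun hvT k
    simp only [Matrix.vecMul, dotProduct, hφ.bergmanTensor_apply hD hc, Pi.zero_apply] at h1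
    have h2 : fderiv ℂ f 0 (Pi.single k 1) = ∑ i, v i * fderiv ℂ (φ i) 0 (Pi.single k 1) := by
      rw [hfdef, fderiv_sum fun i _ => ((hφ i).1.1.differentiableAt hnhds).const_smul (v i)]
      rw [sum_apply]
      refine Finset.sum_congr rfl fun i _ => ?_
      rw [fderiv_const_smul ((hφ i).1.1.differentiableAt hnhds)]
      rfl
    rw [h2]
    have h3 : c⁻¹ * ∑ i, v i * fderiv ℂ (φ i) 0 (Pi.single k 1) = 0 := by
      rw [← h1, Finset.mul_sum]
      exact Finset.sum_congr rfl fun i _ => by ring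
    exact (mul_eq_zero.1 h3).resolve_left (inv_ne_zero hc0)
  have hf0 : EqOn f 0 D := hf.eqOn_zero hD.isOpen (by rw [hpair f hf]; simp [hderiv])
  refine hv (funext fun j => ?_)
  have hj := hpair (fun z => z j) (memBergmanSpace_of_bounded hD.isOpen hD.isBounded
    (differentiable_apply j))
  rw [setIntegral_congr_fun hD.isOpen.measurableSet (g := fun _ => 0) fun z hz => by
    simp [hf0 hz], integral_zero, Finset.sum_eq_single j] at hj
  · have := (hasFDerivAt_apply (𝕜 := ℂ) j (0 : Fin n → ℂ)).fderiv
    rw [this] at hj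
    simpa using hj.symm
  · intro b _ hb
    have := (hasFDerivAt_apply (𝕜 := ℂ) j (0 : Fin n → ℂ)).fderiv
    rw [this]
    simp [Ne.symm hb]
  · simp

theorem RepresentsPartials.representativeCoordinates_apply (hD : IsBoundedQuasiReinhardt D m)
    (hφ : RepresentsPartials D φ) {c : ℂ} (hc0 : c ≠ 0) (hc : ∀ z ∈ D, bergmanKernel D z 0 = c)
    {z : Fin n → ℂ} (hz : z ∈ D) (i : Fin n) :
    representativeCoordinates D 0 z i = ∑ k, (bergmanTensor D 0 0)⁻¹ i k * (c⁻¹ * φ k z) := by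
  simp only [representativeCoordinates, Matrix.mulVec, dotProduct,
    hφ.wirtingerBarLog_eq hD hc0 hc hz]

/-- The representative coordinates at the origin are equivariant under the torus action. -/
theorem RepresentsPartials.isSemiInvariant_representativeCoordinates
    (hD : IsBoundedQuasiReinhardt D m) (hφ : RepresentsPartials D φ) {c : ℂ} (hc0 : c ≠ 0)
    (hc : ∀ z ∈ D, bergmanKernel D z 0 = c) (hc' : ∀ w ∈ D, bergmanKernel D 0 w = c) (i : Fin n) :
    IsSemiInvariant m D (m i) fun z => representativeCoordinates D 0 z i := by
  intro lam z hz
  set T := bergmanTensor D 0 0 with hT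
  have hunit : IsUnit T.det := hφ.isUnit_det hD hc0 hc'
  set d : Matrix (Fin n) (Fin n) ℂ := Matrix.diagonal fun k => character (m k) lam with hd
  -- The function ∂_kφ_i has weight m_i - m_k, and 0 is a fixed point. So T_{ik} can be nonzero only
  -- if m_i = m_k, and T preserves weight spaces.
  have hcomm : T * d = d * T := by
    ext i k
    rw [hd, Matrix.mul_diagonal, Matrix.diagonal_mul, hT, hφ.bergmanTensor_apply hD hc']
    have := (hφ.isSemiInvariant hD i).fderiv_apply hD.isOpen hD.invariant (hφ i).1.1 k lam 0
      hD.zero_mem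
    simp only [torusAction_zero] at this
    rw [character_sub, div_mul_eq_mul_div, eq_div_iff (character_ne_zero _ _)] at this
    linear_combination c⁻¹ * this
  have hcomm' : T⁻¹ * d = d * T⁻¹ := by
    calc T⁻¹ * d = T⁻¹ * (d * T) * T⁻¹ := by
          rw [Matrix.mul_assoc, Matrix.mul_assoc, Matrix.mul_nonsing_inv _ hunit, Matrix.mul_one]
      _ = d * T⁻¹ := by
          rw [← hcomm, ← Matrix.mul_assoc, Matrix.nonsing_inv_mul _ hunit, Matrix.one_mul]
  dsimp only
  rw [hφ.representativeCoordinates_apply hD hc0 hc hz,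
    hφ.representativeCoordinates_apply hD hc0 hc (hD.invariant lam z hz), Finset.mul_sum]
  refine Finset.sum_congr rfl fun k _ => ?_
  have hik := congrFun (congrFun hcomm' i) k
  rw [hd, Matrix.mul_diagonal, Matrix.diagonal_mul] at hik
  rw [hφ.isSemiInvariant hD k lam z hz]
  linear_combination (c⁻¹ * φ k z) * hik

theorem RepresentsPartials.differentiableOn_representativeCoordinates
    (hD : IsBoundedQuasiReinhardt D m) (hφ : RepresentsPartials D φ) {c : ℂ} (hc0 : c ≠ 0)
    (hc : ∀ z ∈ D, bergmanKernel D z 0 = c) (i : Fin n) :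
    DifferentiableOn ℂ (fun z => representativeCoordinates D 0 z i) D := by
  refine DifferentiableOn.congr (f := fun z => ∑ k, (bergmanTensor D 0 0)⁻¹ i k * (c⁻¹ * φ k z))
    (DifferentiableOn.fun_sum fun k _ => ((hφ k).1.1.const_mul _).const_mul _) fun z hz =>
    hφ.representativeCoordinates_apply hD hc0 hc hz i

/-- The representative coordinates are tangent to the identity at the origin. -/
theorem RepresentsPartials.fderiv_representativeCoordinates
    (hD : IsBoundedQuasiReinhardt D m) (hφ : RepresentsPartials D φ) {c : ℂ} (hc0 : c ≠ 0)
    (hc : ∀ z ∈ D, bergmanKernel D z 0 = c) (hc' : ∀ w ∈ D, bergmanKernel D 0 w = c)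
    (i k : Fin n) :
    fderiv ℂ (fun z => representativeCoordinates D 0 z i) 0 (Pi.single k 1) =
      if k = i then 1 else 0 := by
  have hnhds := hD.isOpen.mem_nhds hD.zero_mem
  have hev : (fun z => representativeCoordinates D 0 z i) =ᶠ[𝓝 0]
      fun z => ∑ l, (bergmanTensor D 0 0)⁻¹ i l * (c⁻¹ * φ l z) := by
    filter_upwards [hnhds] with z hz using hφ.representativeCoordinates_apply hD hc0 hc hz i
  have hder : HasFDerivAt (fun z => ∑ l, (bergmanTensor D 0 0)⁻¹ i l * (c⁻¹ * φ l z))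
      (∑ l, (bergmanTensor D 0 0)⁻¹ i l • c⁻¹ • fderiv ℂ (φ l) 0) 0 :=
    HasFDerivAt.fun_sum fun l _ =>
      (((hφ l).1.1.differentiableAt hnhds).hasFDerivAt.const_mul _).const_mul _
  rw [hev.fderiv_eq, hder.fderiv, sum_apply]
  -- The factors c⁻¹∂_kφ_l(0) are the entries of T, so the Jacobian is T⁻¹T.
  have hmul := congrFun (congrFun
    (Matrix.nonsing_inv_mul _ (hφ.isUnit_det hD hc0 hc')) i) k
  rw [Matrix.mul_apply, Matrix.one_apply] at hmul
  simp only [hφ.bergmanTensor_apply hD hc'] at hmul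
  simp only [smul_apply, smul_eq_mul]
  rw [hmul]
  simp [eq_comm]

end RepresentativeCoordinates

end QuasiReinhardt

end

/-! ### The main theorem. -/

open QuasiReinhardt in
theorem proposition2p2 {n r : ℕ} (D : Set (Fin n → ℂ)) (m : Fin n → Fin r → ℤ)
    (hD : IsBoundedQuasiReinhardt D m) (hm : ProperlyOrdered m) :
    -- the representative coordinates at the origin are well defined on all of `D`
    (∀ z ∈ D, bergmanKernel D z 0 ≠ 0) ∧ IsUnit (bergmanTensor D 0 0).det ∧
    -- form of the components of `σ`
    (∃ g : Fin n → MvPolynomial (Fin n) ℂ, (∀ i, OnlyNonlinearResonant m i (g i)) ∧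
      ∀ z ∈ D, ∀ i, representativeCoordinates D 0 z i = z i + MvPolynomial.eval z (g i)) ∧
    -- `σ` is invertible onto its image, and the components of `σ⁻¹` have the same form
    Set.InjOn (representativeCoordinates D 0) D ∧
    (∃ h : Fin n → MvPolynomial (Fin n) ℂ, (∀ i, OnlyNonlinearResonant m i (h i)) ∧
      ∀ w ∈ representativeCoordinates D 0 '' D, ∀ i,
        Function.invFunOn (representativeCoordinates D 0) D w i =
          w i + MvPolynomial.eval w (h i)) := by
  classical
  choose φ hφ using fun k : Fin n =>
    exists_representing_fderiv hD.isOpen hD.zero_mem (Pi.single k 1)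
  have hφ : RepresentsPartials D φ := hφ
  obtain ⟨c, hc0, -, hc, hc'⟩ := exists_bergmanKernel_zero_eq hD
  choose P hPw hP using fun i => exists_eval_eq hD.isOpen hD.isConnected.isPreconnected
    hD.zero_mem hD.invariant hD.onlyConstantInvariants
    (hφ.differentiableOn_representativeCoordinates hD hc0 hc i)
    (hφ.isSemiInvariant_representativeCoordinates hD hc0 hc hc' i)
  have hlin : ∀ i k, MvPolynomial.coeff (Finsupp.single k 1) (P i) = if k = i then 1 else 0 := by
    intro i k
    have hev : (fun z => representativeCoordinates D 0 z i) =ᶠ[nhds 0]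
        fun z => MvPolynomial.eval z (P i) := by
      filter_upwards [hD.isOpen.mem_nhds hD.zero_mem] with z hz using hP i z hz
    rw [← fderiv_eval_zero, ← hev.fderiv_eq,
      hφ.fderiv_representativeCoordinates hD hc0 hc hc' i k]
  have hg : ∀ i, OnlyNonlinearResonant m i (P i - MvPolynomial.X i) := fun i =>
    onlyNonlinearResonant_sub_X hD.onlyConstantInvariants (hPw i) (hlin i)
  have hσ : ∀ z ∈ D, ∀ i, representativeCoordinates D 0 z i =
      z i + MvPolynomial.eval z (P i - MvPolynomial.X i) := by
    intro z hz i
    rw [hP i z hz, map_sub, MvPolynomial.eval_X]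
    ring
  obtain ⟨h, hh, hinv⟩ := exists_inverse hD.onlyConstantInvariants hm hg
  -- The polynomial inverse recovers z from σ(z), which gives injectivity and so identifies
  -- `invFunOn` on the image.
  have hinj : Set.InjOn (representativeCoordinates D 0) D := by
    intro z hz w hw heq
    ext i
    rw [hinv z _ (hσ z hz) i, hinv w _ (hσ w hw) i, heq]
  refine ⟨fun z hz => by rwa [hc z hz], hφ.isUnit_det hD hc0 hc', ⟨_, hg, hσ⟩, hinj, h, hh, ?_⟩
  rintro _ ⟨z, hz, rfl⟩ i
  rw [hinj.leftInvOn_invFunOn hz]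
  exact hinv z _ (hσ z hz) i
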